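/- \textbf{Local consistency of the chromatic tree (of Brown, Ellen and Ruppert).} \emph{The data structure.} The tree is a leaf-oriented search tree with weighted cells. Leaves refer to key nodes, which carry the keys of a linearly ordered set and can be marked (logically deleted); internal cells hold a routing key and two child pointers. A chromatic tree is such a tree in which every leaf has weight at least $1$ and all paths from the root to a leaf have the same total weight. The entry pointer leads to a sentinel leaf of key $\infty$ if the set is empty, and otherwise to a sentinel of key $\infty$ whose left child is the root of the chromatic tree and whose right child is the sentinel leaf. Updates are made copy-on-write: in one atomic step, one pointer of the current tree that leads to a connected group of cells is redirected to a newly allocated group of cells; replaced cells and their outgoing pointers stay in memory. A step that is not applicable changes nothing. A copy of a leaf refers to the same key node. $\mathcal O$ is the set of all memory states $T$ in which the current tree is a chromatic tree with its sentinels and every allocated cell (in the current tree or not) leads to a finite tree of cells. \emph{Views.} The sequential iterator traverses the tree depth-first from left to right and skips marked key nodes. For a key node $N$ of $T$, the view $V(N,T)$ is the set of unmarked key nodes that the sequential iterator on $T$ visits after $N$. The view of an iterator that is paused in an arbitrary state (a stack of allocated cells still to be visited, or visited cells whose right child pointer is still to be read, including cells that have been removed from the tree, or the entry pointer) is the set of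 unmarked key nodes that it would still visit if it ran solo from that state on. \emph{Local consistency.} An atomic step is a map $m:\mathcal O\to\mathcal O$. It is locally consistent with change set $R$ if for every $T\in\mathcal O$: $V(N,T)\,\triangle\,V(N,m(T))\subseteq R$ for every key node $N$ of $T$ (except those $N\in R$ that $m$ has removed from the tree), and for every paused iterator the symmetric difference of its views in $T$ and in $m(T)$ is contained in $R$. An operation is locally consistent with change set $R$ if each of its atomic steps maps $\mathcal O$ to $\mathcal O$ and is locally consistent with change set $R$. \emph{Theorem.} Over any linearly ordered set of keys: 1. Insertion of a new key node $u$ (a leaf at the end of the search path of its key is replaced by an internal cell whose children are a leaf for $u$ and a copy of the old leaf) is locally consistent with change set $\{u\}$. 2. Deletion of a key node $M$, which consists of marking $M$ and physically removing the marked $M$ (its leaf, the parent and the sibling are replaced by a copy of the sibling), is locally consistent with change set $\{M\}$. The physical removal leaves the view of every paused iterator unchanged. 3. Each of the $22$ rebalancing steps of the chromatic tree (BLK, RB1, RB2, PUSH, W1, ..., W7 and their mirror images), and likewise the inverse of each of them, is locally consistent with the empty change set, and leaves the view of every paused iterator unchanged. -/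

import Mathlib

namespace Chromatic

/-- Memory addresses of the cells of the tree. Memory is never reclaimed. -/
abbrev Addr := ℕ

/-- A key node: the object that carries an element of the set. Distinct key nodes may carry
the same key (a key may be inserted, deleted and inserted again), so nodes have identities. -/
@[ext] structure KeyNode (K : Type*) where
  ident : ℕ
  key : K

/-- A cell of the leaf-oriented tree. Every cell has a weight. A leaf holds a reference to a key
node; the sentinel leaf (key infinity) holds `none`. An internal cell has a routing key and two
child pointers; the routing key `⊤` (infinity) is that of a sentinel. -/
inductive Cell (K : Type*) where
  | leaf (w : ℕ) (x : Option (KeyNode K))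
  | internal (w : ℕ) (k : WithTop K) (left right : Addr)

/-- The shared memory: the entry pointer `root`, the cells (those unlinked from the tree persist),
and the key nodes that have been marked as logically deleted. -/
structure Mem (K : Type*) where
  root : Addr
  cell : Addr → Option (Cell K)
  marked : Set (KeyNode K)

inductive Side where
  | left
  | right

/-- A mutable pointer of the tree: the entry pointer, or a child pointer of a cell. -/
inductive Slot where
  | root
  | child (a : Addr) (s : Side)

/-- A connected piece of a tree: cells with their addresses and contents, cut off at pointers
`ptr a` to cells that do not belong to the piece. -/
inductive Patch (K : Type*) where
  | ptr (a : Addr)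
  | leaf (a : Addr) (w : ℕ) (x : Option (KeyNode K))
  | node (a : Addr) (w : ℕ) (k : WithTop K) (l r : Patch K)

/-- The key of a leaf; the sentinel leaf has key infinity. -/
def leafKey {K : Type*} : Option (KeyNode K) → WithTop K
  | none => ⊤
  | some N => (N.key : WithTop K)

namespace Patch

variable {K : Type*}

/-- The address of the topmost cell. -/
def addr : Patch K → Addr
  | ptr a => a
  | leaf a _ _ => a
  | node a _ _ _ _ => a

/-- The weight of the topmost cell of the piece (`0` if the piece has no cell). -/
def weight : Patch K → ℕ
  | ptr _ => 0
  | leaf _ w _ => w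
  | node _ w _ _ _ => w

/-- Change the weight of the topmost cell. -/
def setWeight (v : ℕ) : Patch K → Patch K
  | ptr a => ptr a
  | leaf a _ x => leaf a v x
  | node a _ k l r => node a v k l r

/-- A copy of the topmost cell, at address `b` and with weight `v`: same key, same children, and,
for a leaf, same key node. -/
def copy (b : Addr) (v : ℕ) : Patch K → Patch K
  | ptr a => ptr a
  | leaf _ _ x => leaf b v x
  | node _ _ k l r => node b v k l r

/-- Mirror image. -/
def mirror : Patch K → Patch K
  | ptr a => ptr a
  | leaf a w x => leaf a w x
  | node a w k l r => node a w k r.mirror l.mirror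

/-- The cells of the piece, with their addresses. -/
def cells : Patch K → List (Addr × Cell K)
  | ptr _ => []
  | leaf a w x => [(a, .leaf w x)]
  | node a w k l r => (a, .internal w k l.addr r.addr) :: (l.cells ++ r.cells)

/-- The contents of the leaves, from left to right. -/
def leaves : Patch K → List (Option (KeyNode K))
  | ptr _ => []
  | leaf _ _ x => [x]
  | node _ _ _ l r => l.leaves ++ r.leaves

/-- The piece is a complete tree: nothing is cut off. -/
def Closed : Patch K → Prop
  | ptr _ => False
  | leaf _ _ _ => True
  | node _ _ _ l r => l.Closed ∧ r.Closed

/-- The piece is present in the memory `σ`. -/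
def In (σ : Mem K) : Patch K → Prop
  | ptr a => σ.cell a ≠ none
  | leaf a w x => σ.cell a = some (.leaf w x)
  | node a w k l r => σ.cell a = some (.internal w k l.addr r.addr) ∧ l.In σ ∧ r.In σ

/-- Leaf-oriented search tree: keys smaller than the routing key are on the left, the others on
the right. -/
def IsSearchTree [LinearOrder K] : Patch K → Prop
  | ptr _ => True
  | leaf _ _ _ => True
  | node _ _ k l r =>
      (∀ x ∈ l.leaves, leafKey x < k) ∧ (∀ x ∈ r.leaves, k ≤ leafKey x) ∧
        l.IsSearchTree ∧ r.IsSearchTree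

/-- Every path from the top to a leaf has total weight `h`. -/
def PathWeight : Patch K → ℕ → Prop
  | ptr _, _ => False
  | leaf _ w _, h => h = w
  | node _ w _ l r, h => ∃ g, h = w + g ∧ l.PathWeight g ∧ r.PathWeight g

/-- Every leaf has weight at least one. -/
def LeavesPositive : Patch K → Prop
  | ptr _ => True
  | leaf _ w _ => 1 ≤ w
  | node _ _ _ l r => l.LeavesPositive ∧ r.LeavesPositive

/-- A chromatic tree: a leaf-oriented search tree whose leaves hold keys and have positive weight,
and in which all paths from the root to a leaf have the same total weight. -/
structure IsChromaticTree [LinearOrder K] (t : Patch K) : Prop where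
  closed : t.Closed
  noSentinel : ∀ x ∈ t.leaves, x ≠ none
  search : t.IsSearchTree
  positive : t.LeavesPositive
  balanced : ∃ h, t.PathWeight h

/-- The whole tree below the entry pointer: the sentinel leaf if the set is empty; otherwise a
sentinel whose left child is the root of the chromatic tree and whose right child is the sentinel
leaf. -/
def IsWholeTree [LinearOrder K] (t : Patch K) : Prop :=
  (∃ a w, t = leaf a w none) ∨
    ∃ a w c b v, t = node a w ⊤ c (leaf b v none) ∧ c.IsChromaticTree

end Patch

section Structures

variable {K : Type*}

/-- The collection of all data structures: the memory below the entry pointer stores a chromatic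
tree (with its sentinels), and every cell ever allocated, in the tree or unlinked from it, still
leads to a finite tree of cells. -/
structure IsStructure [LinearOrder K] (σ : Mem K) : Prop where
  tree : ∃ t : Patch K, t.addr = σ.root ∧ t.In σ ∧ t.IsWholeTree
  memory : ∀ a, σ.cell a ≠ none → ∃ t : Patch K, t.addr = a ∧ t.Closed ∧ t.In σ

/-! ### Iterators and views -/

/-- A pending task of a depth-first traversal. `start`: read the entry pointer. `enter a`: visit
the cell `a`, whose address has been read. `resume a`: the internal cell `a` has been visited and
its left child pointer has been followed; its right child pointer is still to be read. -/
inductive Frame where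
  | start
  | enter (a : Addr)
  | resume (a : Addr)

/-- The state of an iterator: the stack of its pending tasks. -/
abbrev Iter := List Frame

/-- One step of the sequential iterator (depth-first, from left to right). -/
def next (σ : Mem K) : Iter → Iter
  | [] => []
  | .start :: s => .enter σ.root :: s
  | .enter a :: s =>
      match σ.cell a with
      | some (.internal _ _ l _) => .enter l :: .resume a :: s
      | _ => s
  | .resume a :: s =>
      match σ.cell a with
      | some (.internal _ _ _ r) => .enter r :: s
      | _ => s

/-- The key node visited in the next step of the iterator, if any. -/
def visits (σ : Mem K) : Iter → Option (KeyNode K)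
  | .enter a :: _ =>
      match σ.cell a with
      | some (.leaf _ x) => x
      | _ => none
  | _ => none

/-- The iterator state refers only to allocated cells, which may have been unlinked meanwhile. -/
def IsIterator (σ : Mem K) (s : Iter) : Prop :=
  ∀ f ∈ s, match f with
    | .start => True
    | .enter a => σ.cell a ≠ none
    | .resume a => σ.cell a ≠ none

/-- The view of an iterator in state `s`: the set of unmarked key nodes that it would still
visit were it to run solo. -/
def iterView (σ : Mem K) (s : Iter) : Set (KeyNode K) :=
  {M | (∃ n, visits σ ((next σ)^[n] s) = some M) ∧ M ∉ σ.marked}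

/-- The key nodes of the data structure, marked or not. -/
def nodes (σ : Mem K) : Set (KeyNode K) :=
  {N | ∃ n, visits σ ((next σ)^[n] [.start]) = some N}

/-- The visiting order: a sequential iterator visits `N` before `M`. -/
def VisitedBefore (σ : Mem K) (N M : KeyNode K) : Prop :=
  ∃ i j, i < j ∧ visits σ ((next σ)^[i] [.start]) = some N ∧
    visits σ ((next σ)^[j] [.start]) = some M

/-- The view `V(N, σ)` relative to a key node `N`. -/
def nodeView (N : KeyNode K) (σ : Mem K) : Set (KeyNode K) :=
  {M | VisitedBefore σ N M ∧ M ∉ σ.marked}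

/-! ### Mutators and local consistency -/

/-- `m` maps data structures to data structures. -/
def IsMutator [LinearOrder K] (m : Mem K → Mem K) : Prop :=
  ∀ σ, IsStructure σ → IsStructure (m σ)

/-- Local consistency with change set `R`: the views `V(N, ·)`, and the views of all paused
iterators, change at most by elements of `R`. `V(N, m σ)` is meaningless if `N` belongs to the
change set and is no longer in `m σ`; iterators that visited such an `N` last are covered by the
second clause. -/
def LocallyConsistent [LinearOrder K] (m : Mem K → Mem K) (R : Set (KeyNode K)) : Prop :=
  ∀ σ, IsStructure σ →
    (∀ N ∈ nodes σ, (N ∈ R → N ∈ nodes (m σ)) →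
      symmDiff (nodeView N σ) (nodeView N (m σ)) ⊆ R) ∧
    (∀ s, IsIterator σ s → symmDiff (iterView σ s) (iterView (m σ) s) ⊆ R)

/-- The mutator leaves the view of every iterator unchanged. -/
def PreservesViews [LinearOrder K] (m : Mem K → Mem K) : Prop :=
  ∀ σ, IsStructure σ → ∀ s, IsIterator σ s → iterView (m σ) s = iterView σ s

/-- An operation, given by the set of its possible atomic steps, is locally consistent with change
set `R` if all its atomic steps are. -/
def OpLocallyConsistent [LinearOrder K] (op : Set (Mem K → Mem K)) (R : Set (KeyNode K)) : Prop :=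
  ∀ m ∈ op, IsMutator m ∧ LocallyConsistent m R

/-! ### Copy-on-write updates -/

/-- The cells of the current tree. -/
inductive Live (σ : Mem K) : Addr → Prop where
  | root : Live σ σ.root
  | left {a w k l r} : Live σ a → σ.cell a = some (.internal w k l r) → Live σ l
  | right {a w k l r} : Live σ a → σ.cell a = some (.internal w k l r) → Live σ r

/-- The value of a pointer. -/
def Slot.read (σ : Mem K) : Slot → Option Addr
  | .root => some σ.root
  | .child a s =>
      match σ.cell a, s with
      | some (.internal _ _ l _), .left => some l
      | some (.internal _ _ _ r), .right => some r
      | _, _ => none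

/-- The pointer belongs to the current tree. -/
def Slot.IsLive (σ : Mem K) : Slot → Prop
  | .root => True
  | .child a _ => Live σ a

/-- The pointer belongs to a sentinel. -/
def Slot.IsSentinel (σ : Mem K) : Slot → Prop
  | .root => True
  | .child a _ => ∃ w l r, σ.cell a = some (.internal w ⊤ l r)

/-- Replace a child pointer of a cell. -/
def Cell.setChild (s : Side) (b : Addr) : Cell K → Cell K
  | .leaf w x => .leaf w x
  | .internal w k l r =>
      match s with
      | .left => .internal w k b r
      | .right => .internal w k l b

/-- Write the cells of the piece `p` into the memory. -/
def Mem.alloc (σ : Mem K) (p : Patch K) : Mem K :=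
  { σ with cell := fun a => (p.cells.lookup a).or (σ.cell a) }

/-- Let a pointer point to `b`. -/
def Mem.write (σ : Mem K) (b : Addr) : Slot → Mem K
  | .root => { σ with root := b }
  | .child a s =>
      { σ with cell := Function.update σ.cell a ((σ.cell a).map (Cell.setChild s b)) }

/-- The situation in which the piece `old`, to which the pointer `q` of the current tree points,
can be replaced by the new piece `new`: all cells of `new` are newly allocated. -/
structure Replaceable (σ : Mem K) (q : Slot) (old new : Patch K) : Prop where
  live : q.IsLive σ
  points : q.read σ = some old.addr
  present : old.In σ
  fresh : ∀ e ∈ new.cells, σ.cell e.1 = none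
  distinct : (new.cells.map Prod.fst).Nodup

open Classical in
/-- The atomic step that replaces `old` by `new` below the pointer `q` if the condition `C` holds,
and fails, changing nothing, otherwise. The replaced cells remain in memory. -/
noncomputable def swing (C : Mem K → Prop) (q : Slot) (old new : Patch K) (σ : Mem K) : Mem K :=
  if Replaceable σ q old new ∧ C σ then (σ.alloc new).write new.addr q else σ

/-- `rel` relates `old` to `new`, except that below a sentinel the topmost cell of `new` may get
weight one instead. -/
def UpToRootWeight (rel : Patch K → Patch K → Prop) (q : Slot) (old new : Patch K)
    (σ : Mem K) : Prop :=
  rel old new ∨ (q.IsSentinel σ ∧ new.weight = 1 ∧ ∃ w, rel old (new.setWeight w))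

/-! ### Insertion and deletion -/

/-- The cells on the search path of `k`. -/
inductive OnSearchPath [LinearOrder K] (σ : Mem K) (k : K) : Addr → Prop where
  | root : OnSearchPath σ k σ.root
  | left {a w j l r} : OnSearchPath σ k a → σ.cell a = some (.internal w j l r) →
      (k : WithTop K) < j → OnSearchPath σ k l
  | right {a w j l r} : OnSearchPath σ k a → σ.cell a = some (.internal w j l r) →
      j ≤ (k : WithTop K) → OnSearchPath σ k r

/-- Insertion replaces a leaf by an internal cell with two leaves: one for the new key node `u`
and a copy of the old leaf. The routing key is the larger of the two keys. -/
inductive InsertRule [LinearOrder K] (u : KeyNode K) : Patch K → Patch K → Prop where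
  | left (a n b c w : ℕ) (x : Option (KeyNode K)) (h : (u.key : WithTop K) < leafKey x) :
      InsertRule u (.leaf a w x) (.node n (w - 1) (leafKey x) (.leaf b 1 (some u)) (.leaf c 1 x))
  | right (a n b c w : ℕ) (x : Option (KeyNode K)) (h : leafKey x < (u.key : WithTop K)) :
      InsertRule u (.leaf a w x) (.node n (w - 1) u.key (.leaf c 1 x) (.leaf b 1 (some u)))

/-- The atomic step of inserting the new key node `u`, at the leaf where the search for its key
ends. -/
noncomputable def insertStep [LinearOrder K] (u : KeyNode K) (q : Slot) (old new : Patch K) :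
    Mem K → Mem K :=
  swing (fun σ => UpToRootWeight (InsertRule u) q old new σ ∧ OnSearchPath σ u.key old.addr ∧
    u ∉ σ.marked ∧ ∀ a w, σ.cell a ≠ some (.leaf w (some u))) q old new

/-- Physical removal replaces the leaf of `M`, its parent and its sibling by a copy of the sibling,
which absorbs the weight of the parent. -/
inductive RemoveRule (M : KeyNode K) : Patch K → Patch K → Prop where
  | left (a b c w v : ℕ) (k : WithTop K) (S : Patch K) (h : ∀ e, S ≠ .ptr e) :
      RemoveRule M (.node a w k (.leaf b v (some M)) S) (S.copy c (w + S.weight))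
  | right (a b c w v : ℕ) (k : WithTop K) (S : Patch K) (h : ∀ e, S ≠ .ptr e) :
      RemoveRule M (.node a w k S (.leaf b v (some M))) (S.copy c (w + S.weight))

/-- The atomic step of physically removing the marked key node `M`. -/
noncomputable def removeStep (M : KeyNode K) (q : Slot) (old new : Patch K) : Mem K → Mem K :=
  swing (fun σ => UpToRootWeight (RemoveRule M) q old new σ ∧ M ∈ σ.marked) q old new

open Classical in
/-- The atomic step of marking the key node `M` of the data structure. -/
noncomputable def markStep (M : KeyNode K) (σ : Mem K) : Mem K :=
  if M ∈ nodes σ then { σ with marked := insert M σ.marked } else σ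

/-- The atomic steps of physical removal of `M`. -/
def removalSteps (M : KeyNode K) : Set (Mem K → Mem K) :=
  {m | ∃ q old new, m = removeStep M q old new}

/-- Insertion of the key node `u`. -/
def insertion [LinearOrder K] (u : KeyNode K) : Set (Mem K → Mem K) :=
  {m | ∃ q old new, m = insertStep u q old new}

/-- Deletion of the key node `M`: marking and physical removal. -/
def deletion (M : KeyNode K) : Set (Mem K → Mem K) :=
  {markStep M} ∪ removalSteps M

/-! ### Rebalancing -/

/-- The names of the rebalancing steps, up to mirror images. -/
inductive RotationName where
  | BLK | RB1 | RB2 | PUSH | W1 | W2 | W3 | W4 | W5 | W6 | W7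

open Patch in
/-- The rebalancing steps: `Rule r old new` if the step `r` replaces `old` by `new`. The addresses
with a digit are those of the new cells. `U` and `V` stand for cells, leaves or internal, that are
copied with a weight reduced by one. Guards on the weights of cells that are not copied, which only
decide which of several applicable steps is chosen, are omitted. -/
inductive Rule : RotationName → Patch K → Patch K → Prop where
  | BLK (x y z x1 y1 z1 w a b c d : ℕ) (k i j : WithTop K) :
      Rule .BLK
        (node x (w + 1) k (node y 0 i (ptr a) (ptr b)) (node z 0 j (ptr c) (ptr d)))
        (node x1 w k (node y1 1 i (ptr a) (ptr b)) (node z1 1 j (ptr c) (ptr d)))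
  | RB1 (x y x1 y1 w a b c : ℕ) (k i : WithTop K) :
      Rule .RB1
        (node x w k (node y 0 i (ptr a) (ptr b)) (ptr c))
        (node x1 w i (ptr a) (node y1 0 k (ptr b) (ptr c)))
  | RB2 (x y z x1 y1 z1 w a b c d : ℕ) (k i j : WithTop K) :
      Rule .RB2
        (node x w k (node y 0 i (ptr a) (node z 0 j (ptr b) (ptr c))) (ptr d))
        (node x1 w j (node y1 0 i (ptr a) (ptr b)) (node z1 0 k (ptr c) (ptr d)))
  | PUSH (x z x1 u1 z1 w c d : ℕ) (k j : WithTop K) (U : Patch K) (hU : 1 < U.weight) :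
      Rule .PUSH
        (node x w k U (node z 1 j (ptr c) (ptr d)))
        (node x1 (w + 1) k (U.copy u1 (U.weight - 1)) (node z1 0 j (ptr c) (ptr d)))
  | W1 (x z x1 z1 u1 v1 w d : ℕ) (k j : WithTop K) (U V : Patch K)
      (hU : 1 < U.weight) (hV : 1 < V.weight) :
      Rule .W1
        (node x w k U (node z 0 j V (ptr d)))
        (node x1 w j
          (node z1 1 k (U.copy u1 (U.weight - 1)) (V.copy v1 (V.weight - 1))) (ptr d))
  | W2 (x y z x1 y1 z1 u1 w b c d : ℕ) (k i j : WithTop K) (U : Patch K) (hU : 1 < U.weight) :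
      Rule .W2
        (node x w k U (node z 0 j (node y 1 i (ptr b) (ptr c)) (ptr d)))
        (node x1 w j
          (node z1 1 k (U.copy u1 (U.weight - 1)) (node y1 0 i (ptr b) (ptr c))) (ptr d))
  | W3 (x y z v x1 y1 z1 v1 u1 w a b c d : ℕ) (k i j h : WithTop K) (U : Patch K)
      (hU : 1 < U.weight) :
      Rule .W3
        (node x w k U
          (node z 0 j (node y 1 i (node v 0 h (ptr a) (ptr b)) (ptr c)) (ptr d)))
        (node x1 w j
          (node z1 0 h (node y1 1 k (U.copy u1 (U.weight - 1)) (ptr a))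
            (node v1 1 i (ptr b) (ptr c)))
          (ptr d))
  | W4 (x y z v x1 y1 z1 v1 u1 w a b c d : ℕ) (k i j h : WithTop K) (U : Patch K)
      (hU : 1 < U.weight) :
      Rule .W4
        (node x w k U
          (node z 0 j (node y 1 i (ptr a) (node v 0 h (ptr b) (ptr c))) (ptr d)))
        (node x1 w i
          (node z1 1 k (U.copy u1 (U.weight - 1)) (ptr a))
          (node y1 0 j (node v1 1 h (ptr b) (ptr c)) (ptr d)))
  | W5 (x y z x1 y1 z1 u1 w a b c : ℕ) (k i j : WithTop K) (U : Patch K) (hU : 1 < U.weight) :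
      Rule .W5
        (node x w k U (node z 1 j (ptr c) (node y 0 i (ptr a) (ptr b))))
        (node x1 w j
          (node z1 1 k (U.copy u1 (U.weight - 1)) (ptr c)) (node y1 1 i (ptr a) (ptr b)))
  | W6 (x y z x1 y1 z1 u1 w a b d : ℕ) (k i j : WithTop K) (U : Patch K) (hU : 1 < U.weight) :
      Rule .W6
        (node x w k U (node z 1 j (node y 0 i (ptr a) (ptr b)) (ptr d)))
        (node x1 w i
          (node z1 1 k (U.copy u1 (U.weight - 1)) (ptr a)) (node y1 1 j (ptr b) (ptr d)))
  | W7 (x x1 u1 v1 w : ℕ) (k : WithTop K) (U V : Patch K)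
      (hU : 1 < U.weight) (hV : 1 < V.weight) :
      Rule .W7
        (node x w k U V)
        (node x1 (w + 1) k (U.copy u1 (U.weight - 1)) (V.copy v1 (V.weight - 1)))

/-- A rebalancing step: one of the eleven steps or its mirror image (these are the 22 rebalancing
steps of the chromatic tree), or the inverse of one of these. -/
structure Rotation where
  name : RotationName
  mirrored : Bool
  inverse : Bool

/-- The replacements made by a rotation or its mirror image. -/
def Oriented (r : RotationName) (mirrored : Bool) (old new : Patch K) : Prop :=
  if mirrored then Rule r old.mirror new.mirror else Rule r old new

/-- The replacements made by a rotation. -/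
def Rotation.Rel (ρ : Rotation) (old new : Patch K) : Prop :=
  if ρ.inverse then Oriented ρ.name ρ.mirrored new old else Oriented ρ.name ρ.mirrored old new

/-- The topmost cell is a sentinel. -/
def Patch.IsSentinel : Patch K → Prop
  | .ptr _ => False
  | .leaf _ _ x => x = none
  | .node _ _ k _ _ => k = ⊤

/-- The atomic step of a rotation, applied inside the chromatic tree. -/
noncomputable def rotationStep (ρ : Rotation) (q : Slot) (old new : Patch K) : Mem K → Mem K :=
  swing (fun σ => UpToRootWeight ρ.Rel q old new σ ∧ ¬ old.IsSentinel) q old new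

/-- The rotation `ρ` as an operation. -/
def Rotation.steps (K : Type*) (ρ : Rotation) : Set (Mem K → Mem K) :=
  {m | ∃ q old new, m = rotationStep ρ q old new}

end Structures

end Chromatic

/-! Views depend only on finite trees. Every allocated address has exactly one complete tree below
it (`Patch.In.unique`, `treeAt`), and a solo run visits, task by task of its stack, the key nodes of
these trees from left to right (`IsStructure.runs`). So the view of a paused iterator is the set of
unmarked elements of a concatenation of lists, and `M` is visited after `N` iff `[N, M]` is a
sublist of the key node list of the current tree.

Let a step redirect the pointer `q` from `old` to `new`. The owner of `q` does not occur below
`old`, since a finite tree is not a proper subtree of itself (`Replaceable.owner_not_mem_old`).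
Hence whatever `new` takes over from `old` is unaffected, and below every previously allocated
address, removed or not, the new tree is the former one with the subtree at `q` exchanged
(`Replaceable.redirect_in`). If the key node lists below `old` and `new` agree outside `R`, then so
do all lists (`Replaceable.framesAgree`), and views change only by elements of `R`. If moreover
every element of `R` is marked, iterator views do not change at all. Views relative to some `N` in
`R` need no argument for redirections: `N` is either new or removed from the tree. Marking changes
no list.

It remains that the current tree stays chromatic. It is a search tree, so a subtree occurs in it
only once, and the step exchanges one subtree at the end of one path (`Replaceable.exists_plug`).
Order, positivity and path weights are then checked locally (`Patch.CanReplace`). For rebalancing,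
every rule is a composition of elementary binary rotations up to addresses and weights
(`Rule.reshape`), and it preserves the list of path weights of the leaves (`Rule.depths_eq`). These
relations are symmetric and compatible with mirroring, which covers the mirror images and the
inverses. -/

namespace Chromatic

variable {K : Type*}

/-! ### Runs of the sequential iterator -/

/-- The sequential iterator, run solo from a state, visits the key nodes of a list in this order
and stops. -/
inductive Runs (σ : Mem K) : Iter → List (KeyNode K) → Prop
  | nil : Runs σ [] []
  | step {f : Frame} {s : Iter} {L : List (KeyNode K)} (h : Runs σ (next σ (f :: s)) L) :
      Runs σ (f :: s) ((visits σ (f :: s)).toList ++ L)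

theorem iterate_next_nil (σ : Mem K) (n : ℕ) : (next σ)^[n] [] = [] := by
  induction n with
  | zero => rfl
  | succ n ih => rw [Function.iterate_succ_apply]; exact ih

theorem Runs.mem_iff {σ : Mem K} {s : Iter} {L : List (KeyNode K)} (h : Runs σ s L)
    (M : KeyNode K) : (∃ n, visits σ ((next σ)^[n] s) = some M) ↔ M ∈ L := by
  induction h with
  | nil => simp [iterate_next_nil, visits]
  | @step f s L h ih =>
    rw [List.mem_append, ← ih, Option.mem_toList]
    constructor
    · rintro ⟨n, hn⟩
      cases n with
      | zero => exact .inl hn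
      | succ n => exact .inr ⟨n, hn⟩
    · rintro (h | ⟨n, hn⟩)
      · exact ⟨0, h⟩
      · exact ⟨n + 1, hn⟩

/-- Either the earlier visit is the first step, or both indices shift by one. Since order is
expressed by sublists, no assumption that a node is visited only once is needed. -/
theorem Runs.before_iff {σ : Mem K} {s : Iter} {L : List (KeyNode K)} (h : Runs σ s L)
    (N M : KeyNode K) :
    (∃ i j, i < j ∧ visits σ ((next σ)^[i] s) = some N ∧ visits σ ((next σ)^[j] s) = some M) ↔
      [N, M].Sublist L := by
  induction h with
  | nil => simp [iterate_next_nil, visits]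
  | @step f s L h ih =>
    have key : (∃ i j, i < j ∧ visits σ ((next σ)^[i] (f :: s)) = some N ∧
        visits σ ((next σ)^[j] (f :: s)) = some M) ↔
        (visits σ (f :: s) = some N ∧ M ∈ L) ∨ [N, M].Sublist L := by
      rw [← ih, ← h.mem_iff]
      constructor
      · rintro ⟨i, j, hij, hi, hj⟩
        obtain ⟨j, rfl⟩ := Nat.exists_eq_succ_of_ne_zero (Nat.ne_zero_of_lt hij)
        cases i with
        | zero => exact .inl ⟨hi, j, hj⟩
        | succ i => exact .inr ⟨i, j, Nat.lt_of_succ_lt_succ hij, hi, hj⟩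
      · rintro (⟨hi, j, hj⟩ | ⟨i, j, hij, hi, hj⟩)
        · exact ⟨0, j + 1, Nat.succ_pos j, hi, hj⟩
        · exact ⟨i + 1, j + 1, Nat.succ_lt_succ hij, hi, hj⟩
    rw [key]
    cases hv : visits σ (f :: s) with
    | none => simp
    | some x =>
      simp only [Option.toList_some, List.cons_append, List.nil_append, List.cons_sublist_cons',
        List.singleton_sublist, Option.some.injEq]
      constructor
      · rintro (⟨rfl, h⟩ | h)
        · exact .inr ⟨rfl, h⟩
        · exact .inl h
      · rintro (h | ⟨rfl, h⟩)
        · exact .inr h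
        · exact .inl ⟨rfl, h⟩

/-! ### Trees in memory: uniqueness below an address, and filling of cut-off pointers -/

namespace Patch

/-- The key nodes of a tree, from left to right. -/
def nodes (t : Patch K) : List (KeyNode K) := t.leaves.reduceOption

/-- The key nodes of the right subtree, from left to right. -/
def rightNodes : Patch K → List (KeyNode K)
  | ptr _ => []
  | leaf _ _ _ => []
  | node _ _ _ _ r => r.nodes

/-- The pointers at which a piece of a tree is cut off, from left to right. -/
def ptrs : Patch K → List Addr
  | ptr a => [a]
  | leaf _ _ _ => []
  | node _ _ _ l r => l.ptrs ++ r.ptrs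

/-- The addresses of the cells of a piece. -/
def addrs (t : Patch K) : List Addr := t.cells.map Prod.fst

@[simp] theorem nodes_leaf (a w : ℕ) (x : Option (KeyNode K)) :
    (leaf a w x).nodes = x.toList := by
  cases x <;> rfl

@[simp] theorem nodes_node (a w : ℕ) (k : WithTop K) (l r : Patch K) :
    (node a w k l r).nodes = l.nodes ++ r.nodes :=
  List.reduceOption_append _ _

theorem mem_nodes {t : Patch K} {M : KeyNode K} : M ∈ t.nodes ↔ some M ∈ t.leaves :=
  List.reduceOption_mem_iff

@[simp] theorem addrs_leaf (a w : ℕ) (x : Option (KeyNode K)) : (leaf a w x).addrs = [a] := rfl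

@[simp] theorem addrs_ptr (a : ℕ) : (ptr a : Patch K).addrs = [] := rfl

@[simp] theorem addrs_node (a w : ℕ) (k : WithTop K) (l r : Patch K) :
    (node a w k l r).addrs = a :: (l.addrs ++ r.addrs) := by
  simp [addrs, cells]

theorem Closed.leaves_ne_nil {t : Patch K} (h : t.Closed) : t.leaves ≠ [] := by
  induction t with
  | ptr => exact h.elim
  | leaf => simp [leaves]
  | node a w k l r ihl ihr => simp [leaves, ihl h.1]

/-- Below an address there is only one tree. -/
theorem In.unique {σ : Mem K} {p q : Patch K} (hp : p.In σ) (hq : q.In σ) (cp : p.Closed)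
    (cq : q.Closed) (h : p.addr = q.addr) : p = q := by
  induction p generalizing q with
  | ptr => exact cp.elim
  | leaf a w x =>
    cases q with
    | ptr => exact cq.elim
    | leaf b v y =>
      obtain rfl : a = b := h
      have := hp.symm.trans hq
      simp_all
    | node b v k l r =>
      obtain rfl : a = b := h
      have := hp.symm.trans hq.1
      simp_all
  | node a w k l r ihl ihr =>
    cases q with
    | ptr => exact cq.elim
    | leaf b v y =>
      obtain rfl : a = b := h
      have := hq.symm.trans hp.1
      simp_all
    | node b v j l' r' =>
      obtain rfl : a = b := h
      have e := hp.1.symm.trans hq.1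
      simp only [Option.some.injEq, Cell.internal.injEq] at e
      obtain ⟨rfl, rfl, h1, h2⟩ := e
      rw [ihl hp.2.1 hq.2.1 cp.1 cq.1 h1, ihr hp.2.2 hq.2.2 cp.2 cq.2 h2]

theorem In.congr {σ σ' : Mem K} {p : Patch K} (hp : p.In σ) (cp : p.Closed)
    (h : ∀ b ∈ p.addrs, σ'.cell b = σ.cell b) : p.In σ' := by
  induction p with
  | ptr => exact cp.elim
  | leaf a w x => exact (h a (by simp)).trans hp
  | node a w k l r ihl ihr =>
    exact ⟨(h a (by simp)).trans hp.1, ihl hp.2.1 cp.1 fun b hb => h b (by simp [hb]),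
      ihr hp.2.2 cp.2 fun b hb => h b (by simp [hb])⟩

theorem In.cell_ne_none {σ : Mem K} {p : Patch K} (hp : p.In σ) : σ.cell p.addr ≠ none := by
  cases p with
  | ptr => exact hp
  | leaf => rw [addr, (show σ.cell _ = _ from hp)]; simp
  | node => rw [addr, hp.1]; simp

theorem In.cell_ne_none_of_mem {σ : Mem K} {p : Patch K} (hp : p.In σ) {b : Addr}
    (hb : b ∈ p.addrs) : σ.cell b ≠ none := by
  induction p with
  | ptr => simp at hb
  | leaf a w x =>
    obtain rfl : b = a := by simpa using hb
    exact hp.cell_ne_none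
  | node a w k l r ihl ihr =>
    simp only [addrs_node, List.mem_cons, List.mem_append] at hb
    rcases hb with rfl | hb | hb
    · exact hp.cell_ne_none
    · exact ihl hp.2.1 hb
    · exact ihr hp.2.2 hb

/-- Replace the pointers of a piece of a tree by trees. -/
def fill (g : Addr → Patch K) : Patch K → Patch K
  | ptr a => g a
  | leaf a w x => leaf a w x
  | node a w k l r => node a w k (l.fill g) (r.fill g)

theorem fill_addr {g : Addr → Patch K} {p : Patch K} (h : ∀ b ∈ p.ptrs, (g b).addr = b) :
    (p.fill g).addr = p.addr := by
  cases p with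
  | ptr a => exact h a (by simp [ptrs])
  | leaf => rfl
  | node => rfl

theorem fill_closed {g : Addr → Patch K} {p : Patch K} (h : ∀ b ∈ p.ptrs, (g b).Closed) :
    (p.fill g).Closed := by
  induction p with
  | ptr a => exact h a (by simp [ptrs])
  | leaf => trivial
  | node a w k l r ihl ihr =>
    exact ⟨ihl fun b hb => h b (by simp [ptrs, hb]), ihr fun b hb => h b (by simp [ptrs, hb])⟩

/-- Presence of the piece is assumed cell by cell because that is what allocation provides for a new
piece. -/
theorem fill_in {σ : Mem K} {g : Addr → Patch K} {p : Patch K}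
    (hc : ∀ e ∈ p.cells, σ.cell e.1 = some e.2)
    (h : ∀ b ∈ p.ptrs, (g b).addr = b ∧ (g b).In σ) : (p.fill g).In σ := by
  induction p with
  | ptr a => exact (h a (by simp [ptrs])).2
  | leaf a w x => exact hc (a, _) (by simp [cells])
  | node a w k l r ihl ihr =>
    have hl : ∀ b ∈ l.ptrs, (g b).addr = b ∧ (g b).In σ := fun b hb => h b (by simp [ptrs, hb])
    have hr : ∀ b ∈ r.ptrs, (g b).addr = b ∧ (g b).In σ := fun b hb => h b (by simp [ptrs, hb])
    refine ⟨?_, ihl (fun e he => hc e (by simp [cells, he])) hl,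
      ihr (fun e he => hc e (by simp [cells, he])) hr⟩
    rw [fill_addr fun b hb => (hl b hb).1, fill_addr fun b hb => (hr b hb).1]
    exact hc (a, _) (by simp [cells])

theorem In.cells {σ : Mem K} {p : Patch K} (hp : p.In σ) :
    ∀ e ∈ p.cells, σ.cell e.1 = some e.2 := by
  induction p with
  | ptr => simp [Patch.cells]
  | leaf a w x => simpa [Patch.cells, In] using hp
  | node a w k l r ihl ihr =>
    intro e he
    simp only [Patch.cells, List.mem_cons, List.mem_append] at he
    rcases he with rfl | he | he
    · exact hp.1
    · exact ihl hp.2.1 e he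
    · exact ihr hp.2.2 e he

theorem In.ptrs {σ : Mem K} {p : Patch K} (hp : p.In σ) : ∀ b ∈ p.ptrs, σ.cell b ≠ none := by
  induction p with
  | ptr => simpa [Patch.ptrs, In] using hp
  | leaf a w x => simp [Patch.ptrs]
  | node a w k l r ihl ihr =>
    intro b hb
    simp only [Patch.ptrs, List.mem_append] at hb
    rcases hb with hb | hb
    · exact ihl hp.2.1 b hb
    · exact ihr hp.2.2 b hb

theorem mem_addrs_fill {g : Addr → Patch K} {p : Patch K} {b : Addr} :
    b ∈ (p.fill g).addrs ↔ b ∈ p.addrs ∨ ∃ c ∈ p.ptrs, b ∈ (g c).addrs := by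
  induction p with
  | ptr a => simp [fill, ptrs]
  | leaf a w x => simp [fill, ptrs]
  | node a w k l r ihl ihr =>
    simp only [fill, addrs_node, List.mem_cons, List.mem_append, ihl, ihr, ptrs, or_and_right,
      exists_or, or_assoc, or_left_comm]

/-! ### Trees with a hole -/

end Patch

/-- One step of a path in a tree: an internal cell, the side that is taken, and the subtree on
the other side. -/
structure Crumb (K : Type*) where
  addr : Addr
  weight : ℕ
  key : WithTop K
  side : Side
  sibling : Patch K

namespace Crumb

/-- The tree below the cell, if `t` is the subtree on the side that is taken. -/
def fill (c : Crumb K) (t : Patch K) : Patch K :=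
  match c.side with
  | .left => .node c.addr c.weight c.key t c.sibling
  | .right => .node c.addr c.weight c.key c.sibling t

/-- A search for the key of `x` takes this step. -/
def Admits [LinearOrder K] (c : Crumb K) (x : Option (KeyNode K)) : Prop :=
  match c.side with
  | .left => leafKey x < c.key
  | .right => c.key ≤ leafKey x

end Crumb

namespace Patch

/-- The tree that consists of the path `C`, whose top comes first, the siblings of its cells, and
`t` at its lower end. -/
def plug (C : List (Crumb K)) (t : Patch K) : Patch K := C.foldr Crumb.fill t

@[simp] theorem plug_nil (t : Patch K) : plug [] t = t := rfl

@[simp] theorem plug_cons (c : Crumb K) (C : List (Crumb K)) (t : Patch K) :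
    plug (c :: C) t = c.fill (plug C t) := rfl

theorem plug_append (C D : List (Crumb K)) (t : Patch K) :
    plug (C ++ D) t = plug C (plug D t) := by simp [plug]

theorem Closed.of_fill {c : Crumb K} {t : Patch K} (h : (c.fill t).Closed) :
    t.Closed ∧ c.sibling.Closed := by
  obtain ⟨a, w, k, s, p⟩ := c
  cases s
  · exact h
  · exact h.symm

theorem Closed.of_plug {C : List (Crumb K)} {t : Patch K} (h : (plug C t).Closed) : t.Closed := by
  induction C with
  | nil => exact h
  | cons c C ih => exact ih h.of_fill.1

theorem Closed.plug {C : List (Crumb K)} {t u : Patch K} (h : (Patch.plug C t).Closed)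
    (hu : u.Closed) : (Patch.plug C u).Closed := by
  induction C with
  | nil => exact hu
  | cons c C ih =>
    have := ih h.of_fill.1
    have h2 := h.of_fill.2
    obtain ⟨a, w, k, s, p⟩ := c
    cases s
    · exact ⟨this, h2⟩
    · exact ⟨h2, this⟩

theorem In.of_fill {σ : Mem K} {c : Crumb K} {t : Patch K} (h : (c.fill t).In σ) :
    t.In σ ∧ c.sibling.In σ := by
  obtain ⟨a, w, k, s, p⟩ := c
  cases s
  · exact h.2
  · exact h.2.symm

theorem In.of_plug {σ : Mem K} {C : List (Crumb K)} {t : Patch K} (h : (plug C t).In σ) :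
    t.In σ := by
  induction C with
  | nil => exact h
  | cons c C ih => exact ih h.of_fill.1

/-- The leaves around the hole are chosen before the filling, so two fillings of one path can be
compared. -/
theorem leaves_plug (C : List (Crumb K)) : ∃ L₁ L₂ : List (Option (KeyNode K)),
    ∀ t, (plug C t).leaves = L₁ ++ t.leaves ++ L₂ := by
  induction C with
  | nil => exact ⟨[], [], by simp⟩
  | cons c C ih =>
    obtain ⟨L₁, L₂, h⟩ := ih
    obtain ⟨a, w, k, s, p⟩ := c
    cases s
    · exact ⟨L₁, L₂ ++ p.leaves, fun t => by simp [Crumb.fill, leaves, h]⟩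
    · exact ⟨p.leaves ++ L₁, L₂, fun t => by simp [Crumb.fill, leaves, h]⟩

theorem leaves_subset_plug (C : List (Crumb K)) (t : Patch K) : t.leaves ⊆ (plug C t).leaves := by
  obtain ⟨L₁, L₂, h⟩ := leaves_plug C
  rw [h t]
  intro x hx
  simp [hx]

/-- A tree is not a proper subtree of itself. -/
theorem plug_ne_self {c : Crumb K} {C : List (Crumb K)} {t : Patch K}
    (h : (plug (c :: C) t).Closed) : plug (c :: C) t ≠ t := by
  intro e
  have h1 := congrArg (fun t => t.leaves.length) e
  -- The sibling is a complete tree and has a leaf, so adding a crumb strictly increases the number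
  -- of leaves.
  have h2 := List.length_pos_iff.2 h.of_fill.2.leaves_ne_nil
  obtain ⟨L₁, L₂, h3⟩ := leaves_plug C
  obtain ⟨a, w, k, s, p⟩ := c
  cases s <;> simp [Crumb.fill, leaves, h3] at h1 h2 <;> omega

theorem exists_plug_of_mem_addrs {t : Patch K} {a : Addr} (h : a ∈ t.addrs) :
    ∃ C A, t = plug C A ∧ A.addr = a := by
  induction t with
  | ptr b => simp at h
  | leaf b w x => exact ⟨[], _, rfl, by simpa [addr, eq_comm] using h⟩
  | node b w k l r ihl ihr =>
    simp only [addrs_node, List.mem_cons, List.mem_append] at h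
    rcases h with rfl | h | h
    · exact ⟨[], _, rfl, rfl⟩
    · obtain ⟨C, A, rfl, hA⟩ := ihl h
      exact ⟨⟨b, w, k, .left, r⟩ :: C, A, rfl, hA⟩
    · obtain ⟨C, A, rfl, hA⟩ := ihr h
      exact ⟨⟨b, w, k, .right, l⟩ :: C, A, rfl, hA⟩

/-- If the tree at `a` contains `A` properly, then it is not contained in `A`. -/
theorem not_mem_addrs {σ : Mem K} {c : Crumb K} {C : List (Crumb K)} {A : Patch K}
    (h : (plug (c :: C) A).In σ) (hc : (plug (c :: C) A).Closed) : c.addr ∉ A.addrs := by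
  intro hm
  obtain ⟨D, B, rfl, hB⟩ := exists_plug_of_mem_addrs hm
  rw [← plug_append] at h hc
  -- The subtree found at the address of `c` inside `A` is, by uniqueness, the tree that contains it
  -- properly.
  have e : B = plug (c :: C ++ D) B :=
    h.of_plug.unique h hc.of_plug hc (by obtain ⟨a, w, k, s, p⟩ := c; cases s <;> exact hB)
  exact plug_ne_self (c := c) (C := C ++ D) hc e.symm

theorem IsSearchTree.of_fill [LinearOrder K] {c : Crumb K} {t : Patch K}
    (h : (c.fill t).IsSearchTree) : t.IsSearchTree := by
  obtain ⟨a, w, k, s, p⟩ := c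
  cases s
  · exact h.2.2.1
  · exact h.2.2.2

theorem IsSearchTree.not_both [LinearOrder K] {a w : ℕ} {k : WithTop K} {l r : Patch K}
    (h : (node a w k l r).IsSearchTree) {x : Option (KeyNode K)} (hl : x ∈ l.leaves) :
    x ∉ r.leaves :=
  fun hr => (lt_of_lt_of_le (h.1 x hl) (h.2.1 x hr)).false

/-- A subtree occurs only once in a search tree. -/
theorem plug_injective [LinearOrder K] {C D : List (Crumb K)} {t : Patch K}
    (hs : (plug C t).IsSearchTree) (hc : (plug C t).Closed) (h : plug C t = plug D t) : C = D := by
  -- If the two paths diverged, this leaf of `t` would lie on both sides of a cell of a search tree.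
  obtain ⟨x, hx⟩ := List.exists_mem_of_ne_nil _ hc.of_plug.leaves_ne_nil
  induction C generalizing D with
  | nil =>
    cases D with
    | nil => rfl
    | cons d D => exact absurd h.symm (plug_ne_self (h ▸ hc))
  | cons c C ih =>
    cases D with
    | nil => exact absurd h (plug_ne_self hc)
    | cons d D =>
      have ih' := fun h => ih hs.of_fill hc.of_fill.1 (D := D) h
      have hC := leaves_subset_plug C t hx
      have hD := leaves_subset_plug D t hx
      obtain ⟨a, w, k, s, p⟩ := c
      obtain ⟨b, v, j, s', p'⟩ := d
      cases s <;> cases s' <;>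
        simp only [plug_cons, Crumb.fill, node.injEq] at h <;>
        obtain ⟨rfl, rfl, rfl, h1, h2⟩ := h
      · rw [ih' h1, h2]
      · exact absurd (h2 ▸ hD) (hs.not_both hC)
      · exact absurd hC (hs.not_both (h1 ▸ hD))
      · rw [ih' h2, h1]

end Patch

/-! ### The tree below an address, and views -/

open Classical in
/-- The tree of cells below the address `a`. -/
noncomputable def treeAt (σ : Mem K) (a : Addr) : Patch K :=
  -- The default has no key nodes; it is not used for allocated cells of a data structure.
  if h : ∃ t : Patch K, t.addr = a ∧ t.Closed ∧ t.In σ then h.choose else .ptr a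

theorem IsStructure.treeAt_spec [LinearOrder K] {σ : Mem K} (hσ : IsStructure σ) {a : Addr}
    (ha : σ.cell a ≠ none) :
    (treeAt σ a).addr = a ∧ (treeAt σ a).Closed ∧ (treeAt σ a).In σ := by
  have h := hσ.memory a ha
  rw [treeAt, dif_pos h]
  exact h.choose_spec

theorem treeAt_eq {σ : Mem K} {t : Patch K} (hc : t.Closed) (ht : t.In σ) {a : Addr}
    (ha : t.addr = a) : treeAt σ a = t := by
  have h : ∃ t : Patch K, t.addr = a ∧ t.Closed ∧ t.In σ := ⟨t, ha, hc, ht⟩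
  rw [treeAt, dif_pos h]
  have hs := h.choose_spec
  exact hs.2.2.unique ht hs.2.1 hc (hs.1.trans ha.symm)

/-- The key nodes that an iterator visits on account of a pending task. -/
noncomputable def frameNodes (σ : Mem K) : Frame → List (KeyNode K)
  | .start => (treeAt σ σ.root).nodes
  | .enter a => (treeAt σ a).nodes
  | .resume a => (treeAt σ a).rightNodes

/-- Induction on the tree for an arbitrary remaining stack: the run of the right subtree is put in
front of the run of the stack, then the run of the left subtree in front of both. -/
theorem Runs.enter {σ : Mem K} {t : Patch K} (hc : t.Closed) (ht : t.In σ) {s : Iter}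
    {L : List (KeyNode K)} (h : Runs σ s L) : Runs σ (.enter t.addr :: s) (t.nodes ++ L) := by
  induction t generalizing s L with
  | ptr => exact hc.elim
  | leaf a w x =>
    have ht : σ.cell a = some (.leaf w x) := ht
    have h1 : next σ (.enter a :: s) = s := by simp [next, ht]
    have h2 : visits σ (.enter a :: s) = x := by simp [visits, ht]
    have := Runs.step (f := .enter a) (s := s) (h1.symm ▸ h)
    rwa [h2] at this
  | node a w k l r ihl ihr =>
    have h1 : next σ (.resume a :: s) = .enter r.addr :: s := by simp [next, ht.1]
    have h2 : visits σ (.resume a :: s) = none := rfl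
    have h3 : next σ (.enter a :: s) = .enter l.addr :: .resume a :: s := by simp [next, ht.1]
    have h4 : visits σ (.enter a :: s) = none := by simp [visits, ht.1]
    have h5 := Runs.step (f := .resume a) (s := s) (h1.symm ▸ ihr hc.2 ht.2.2 h)
    have h6 := Runs.step (f := .enter a) (s := s) (h3.symm ▸ ihl hc.1 ht.2.1 h5)
    simpa [h2, h4, Patch.addr] using h6

theorem Runs.resume {σ : Mem K} {t : Patch K} (hc : t.Closed) (ht : t.In σ) {s : Iter}
    {L : List (KeyNode K)} (h : Runs σ s L) :
    Runs σ (.resume t.addr :: s) (t.rightNodes ++ L) := by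
  cases t with
  | ptr => exact hc.elim
  | leaf a w x =>
    have ht : σ.cell a = some (.leaf w x) := ht
    have h1 : next σ (.resume a :: s) = s := by simp [next, ht]
    exact Runs.step (f := .resume a) (s := s) (h1.symm ▸ h)
  | node a w k l r =>
    have h1 : next σ (.resume a :: s) = .enter r.addr :: s := by simp [next, ht.1]
    exact Runs.step (f := .resume a) (s := s) (h1.symm ▸ h.enter hc.2 ht.2.2)

section

variable [LinearOrder K] {σ : Mem K}

theorem Patch.IsWholeTree.closed {t : Patch K} (h : t.IsWholeTree) : t.Closed := by
  obtain ⟨a, w, rfl⟩ | ⟨a, w, c, b, v, rfl, hc⟩ := h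
  · trivial
  · exact ⟨hc.closed, trivial⟩

theorem IsStructure.root_ne_none (hσ : IsStructure σ) : σ.cell σ.root ≠ none := by
  obtain ⟨t, h1, h2, -⟩ := hσ.tree
  exact h1 ▸ h2.cell_ne_none

/-- Only allocation of the addresses matters, so removed cells are covered as well. -/
theorem IsStructure.runs (hσ : IsStructure σ) {s : Iter} (hs : IsIterator σ s) :
    Runs σ s (s.flatMap (frameNodes σ)) := by
  induction s with
  | nil => exact .nil
  | cons f s ih =>
    have ih := ih fun f hf => hs f (by simp [hf])
    have hf := hs f (by simp)
    rw [List.flatMap_cons]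
    cases f with
    | start =>
      obtain ⟨h1, h2, h3⟩ := hσ.treeAt_spec hσ.root_ne_none
      have := ih.enter h2 h3
      rw [h1] at this
      exact Runs.step (f := .start) (s := s) this
    | enter a =>
      obtain ⟨h1, h2, h3⟩ := hσ.treeAt_spec hf
      have := ih.enter h2 h3
      rwa [h1] at this
    | resume a =>
      obtain ⟨h1, h2, h3⟩ := hσ.treeAt_spec hf
      have := ih.resume h2 h3
      rwa [h1] at this

theorem IsStructure.mem_iterView (hσ : IsStructure σ) {s : Iter} (hs : IsIterator σ s)
    {M : KeyNode K} :
    M ∈ iterView σ s ↔ M ∈ s.flatMap (frameNodes σ) ∧ M ∉ σ.marked :=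
  and_congr_left' ((hσ.runs hs).mem_iff M)

theorem IsStructure.runs_start (hσ : IsStructure σ) :
    Runs σ [.start] (treeAt σ σ.root).nodes := by
  simpa [frameNodes] using hσ.runs (s := [.start]) (by simp [IsIterator])

theorem IsStructure.mem_nodes (hσ : IsStructure σ) {M : KeyNode K} :
    M ∈ nodes σ ↔ M ∈ (treeAt σ σ.root).nodes :=
  hσ.runs_start.mem_iff M

theorem IsStructure.mem_nodeView (hσ : IsStructure σ) {N M : KeyNode K} :
    M ∈ nodeView N σ ↔ [N, M].Sublist (treeAt σ σ.root).nodes ∧ M ∉ σ.marked :=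
  and_congr_left' (hσ.runs_start.before_iff N M)

end

/-! ### Lists that agree up to the elements of a set -/

open Classical in
/-- The lists agree after removal of the elements of `R`. -/
def AgreeOff (R : Set (KeyNode K)) (L L' : List (KeyNode K)) : Prop :=
  L.filter (· ∉ R) = L'.filter (· ∉ R)

namespace AgreeOff

variable {R : Set (KeyNode K)} {L L' P P' : List (KeyNode K)}

theorem refl (R : Set (KeyNode K)) (L : List (KeyNode K)) : AgreeOff R L L := rfl

theorem append (h : AgreeOff R L L') (h' : AgreeOff R P P') :
    AgreeOff R (L ++ P) (L' ++ P') := by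
  unfold AgreeOff at *
  rw [List.filter_append, List.filter_append, h, h']

theorem mem_iff (h : AgreeOff R L L') {M : KeyNode K} (hM : M ∉ R) : M ∈ L ↔ M ∈ L' := by
  classical
  have : M ∈ L.filter (· ∉ R) ↔ M ∈ L'.filter (· ∉ R) := by
    unfold AgreeOff at h
    rw [h]
  simpa [hM] using this

/-- A pair that avoids `R` survives the deletion of the elements of `R` from the list. -/
theorem sublist_iff (h : AgreeOff R L L') {N M : KeyNode K} (hN : N ∉ R) (hM : M ∉ R) :
    [N, M].Sublist L ↔ [N, M].Sublist L' := by
  classical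
  have key : ∀ L : List (KeyNode K), [N, M].Sublist L ↔ [N, M].Sublist (L.filter (· ∉ R)) := by
    intro L
    constructor
    · intro h
      simpa [hN, hM] using h.filter (· ∉ R)
    · exact fun h => h.trans List.filter_sublist
  unfold AgreeOff at h
  rw [key L, key L', h]

end AgreeOff

/-- Passing from `σ` to `σ'`, the key nodes visited on account of any pending task change at most
by elements of `R`. -/
structure FramesAgree (R : Set (KeyNode K)) (σ σ' : Mem K) : Prop where
  alloc : ∀ a, σ.cell a ≠ none → σ'.cell a ≠ none
  start : AgreeOff R (frameNodes σ .start) (frameNodes σ' .start)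
  enter : ∀ a, σ.cell a ≠ none → AgreeOff R (frameNodes σ (.enter a)) (frameNodes σ' (.enter a))
  resume : ∀ a, σ.cell a ≠ none →
    AgreeOff R (frameNodes σ (.resume a)) (frameNodes σ' (.resume a))

theorem FramesAgree.isIterator {R : Set (KeyNode K)} {σ σ' : Mem K} (h : FramesAgree R σ σ')
    {s : Iter} (hs : IsIterator σ s) : IsIterator σ' s := by
  intro f hf
  have := hs f hf
  cases f with
  | start => trivial
  | enter a => exact h.alloc a this
  | resume a => exact h.alloc a this

theorem FramesAgree.flatMap {R : Set (KeyNode K)} {σ σ' : Mem K} (h : FramesAgree R σ σ')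
    {s : Iter} (hs : IsIterator σ s) :
    AgreeOff R (s.flatMap (frameNodes σ)) (s.flatMap (frameNodes σ')) := by
  induction s with
  | nil => exact .refl _ _
  | cons f s ih =>
    have ih := ih fun f hf => hs f (by simp [hf])
    have hf := hs f (by simp)
    rw [List.flatMap_cons, List.flatMap_cons]
    refine .append ?_ ih
    cases f with
    | start => exact h.start
    | enter a => exact h.enter a hf
    | resume a => exact h.resume a hf

section

variable [LinearOrder K] {σ σ' : Mem K} {R : Set (KeyNode K)}

theorem FramesAgree.iterView_symmDiff (h : FramesAgree R σ σ') (hσ : IsStructure σ)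
    (hσ' : IsStructure σ') (hm : ∀ M ∉ R, M ∈ σ.marked ↔ M ∈ σ'.marked) {s : Iter}
    (hs : IsIterator σ s) : symmDiff (iterView σ s) (iterView σ' s) ⊆ R := by
  intro M hM
  by_contra hR
  rw [Set.mem_symmDiff, hσ.mem_iterView hs, hσ'.mem_iterView (h.isIterator hs),
    (h.flatMap hs).mem_iff hR, hm M hR] at hM
  tauto

/-- The only nodes on which the lists may differ are marked, and marked nodes belong to no view. -/
theorem FramesAgree.iterView_eq (h : FramesAgree R σ σ') (hσ : IsStructure σ)
    (hσ' : IsStructure σ') (hm : σ'.marked = σ.marked) (hR : R ⊆ σ.marked) {s : Iter}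
    (hs : IsIterator σ s) : iterView σ' s = iterView σ s := by
  ext M
  rw [hσ.mem_iterView hs, hσ'.mem_iterView (h.isIterator hs), hm]
  by_cases hM : M ∈ R
  · simp [hR hM]
  · rw [(h.flatMap hs).mem_iff hM]

theorem FramesAgree.nodeView_symmDiff (h : FramesAgree R σ σ') (hσ : IsStructure σ)
    (hσ' : IsStructure σ') (hm : ∀ M ∉ R, M ∈ σ.marked ↔ M ∈ σ'.marked) {N : KeyNode K}
    (hN : N ∉ R) : symmDiff (nodeView N σ) (nodeView N σ') ⊆ R := by
  intro M hM
  by_contra hR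
  have key : [N, M].Sublist (treeAt σ σ.root).nodes ↔ [N, M].Sublist (treeAt σ' σ'.root).nodes :=
    AgreeOff.sublist_iff h.start hN hR
  rw [Set.mem_symmDiff, hσ.mem_nodeView, hσ'.mem_nodeView, key, hm M hR] at hM
  tauto

end

/-! ### Redirecting a pointer -/

open Classical in
/-- The tree after the pointer `q` has been redirected to the tree `N`. -/
noncomputable def Patch.redirect (t : Patch K) (q : Slot) (N : Patch K) : Patch K :=
  match t with
  | .ptr a => .ptr a
  | .leaf a w x => .leaf a w x
  | .node a w k l r =>
      -- The recursion does not enter the inserted tree `N`.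
      .node a w k (if q = .child a .left then N else l.redirect q N)
        (if q = .child a .right then N else r.redirect q N)

namespace Patch

variable {q : Slot} {N : Patch K}

@[simp] theorem redirect_addr (t : Patch K) : (t.redirect q N).addr = t.addr := by
  cases t <;> rfl

theorem redirect_closed (hN : N.Closed) {t : Patch K} (h : t.Closed) :
    (t.redirect q N).Closed := by
  induction t with
  | ptr => exact h
  | leaf => exact h
  | node a w k l r ihl ihr =>
    constructor
    · split
      · exact hN
      · exact ihl h.1
    · split
      · exact hN
      · exact ihr h.2

theorem redirect_eq_self {t : Patch K} (h : ∀ a s, q = .child a s → a ∉ t.addrs) :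
    t.redirect q N = t := by
  induction t with
  | ptr => rfl
  | leaf => rfl
  | node a w k l r ihl ihr =>
    have h0 : ∀ s, q ≠ .child a s := fun s hs => h a s hs (by simp)
    rw [redirect, if_neg (h0 _), if_neg (h0 _),
      ihl fun b s hs hb => h b s hs (by simp [hb]),
      ihr fun b s hs hb => h b s hs (by simp [hb])]

end Patch

/-! ### The contents of the memory after the redirection -/

theorem lookup_of_nodup {α β : Type*} [BEq α] [LawfulBEq α] {l : List (α × β)}
    (h : (l.map Prod.fst).Nodup) {e : α × β} (he : e ∈ l) : l.lookup e.1 = some e.2 := by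
  induction l with
  | nil => simp at he
  | cons d l ih =>
    obtain ⟨b, y⟩ := d
    rw [List.map_cons, List.nodup_cons] at h
    rw [List.lookup_cons]
    rcases List.mem_cons.1 he with rfl | he
    · simp
    · have : e.1 ≠ b := fun hb => h.1 (List.mem_map.2 ⟨e, he, hb⟩)
      rw [beq_eq_false_iff_ne.2 this]
      exact ih h.2 he

theorem lookup_eq_none {α β : Type*} [BEq α] [LawfulBEq α] {l : List (α × β)} {a : α}
    (h : a ∉ l.map Prod.fst) : l.lookup a = none := by
  rw [List.lookup_eq_none_iff]
  intro e he
  rw [bne_iff_ne]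
  rintro rfl
  exact h (List.mem_map_of_mem he)

/-- The memory after `new` has been written and the pointer `q` has been redirected to it. -/
def Mem.swung (σ : Mem K) (q : Slot) (new : Patch K) : Mem K := (σ.alloc new).write new.addr q

/-- Reachability is turned into a path in the tree that is extended at its lower end. -/
theorem Live.exists_plug {σ : Mem K} {t : Patch K} (h0 : t.addr = σ.root) (hc : t.Closed)
    (ht : t.In σ) {b : Addr} (h : Live σ b) :
    ∃ C A, t = Patch.plug C A ∧ A.addr = b := by
  induction h with
  | root => exact ⟨[], t, rfl, h0⟩
  | @left a w k l r h e ih =>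
    obtain ⟨C, A, rfl, rfl⟩ := ih
    have hA := ht.of_plug
    cases A with
    | ptr => exact hc.of_plug.elim
    | leaf a v x => exact absurd (e.symm.trans hA) (by simp)
    | node a v j L R =>
      have := e.symm.trans hA.1
      simp only [Option.some.injEq, Cell.internal.injEq] at this
      exact ⟨C ++ [⟨a, v, j, .left, R⟩], L, by simp [Patch.plug_append, Crumb.fill],
        this.2.2.1.symm⟩
  | @right a w k l r h e ih =>
    obtain ⟨C, A, rfl, rfl⟩ := ih
    have hA := ht.of_plug
    cases A with
    | ptr => exact hc.of_plug.elim
    | leaf a v x => exact absurd (e.symm.trans hA) (by simp)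
    | node a v j L R =>
      have := e.symm.trans hA.1
      simp only [Option.some.injEq, Cell.internal.injEq] at this
      exact ⟨C ++ [⟨a, v, j, .right, L⟩], R, by simp [Patch.plug_append, Crumb.fill],
        this.2.2.2.symm⟩

namespace Replaceable

variable {σ : Mem K} {q : Slot} {old new : Patch K}

theorem not_mem_new (h : Replaceable σ q old new) {b : Addr} (hb : σ.cell b ≠ none) :
    b ∉ new.cells.map Prod.fst := by
  intro hm
  obtain ⟨e, he, rfl⟩ := List.mem_map.1 hm
  exact hb (h.fresh e he)

theorem owner (h : Replaceable σ q old new) {a : Addr} {s : Side} (hq : q = .child a s) :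
    ∃ w k l r, σ.cell a = some (.internal w k l r) ∧
      old.addr = match s with | .left => l | .right => r := by
  subst hq
  have := h.points
  cases hc : σ.cell a with
  | none => simp [Slot.read, hc] at this
  | some c =>
    cases c with
    | leaf w x => simp [Slot.read, hc] at this
    | internal w k l r =>
      refine ⟨w, k, l, r, rfl, ?_⟩
      cases s <;> simpa [Slot.read, hc] using this.symm

theorem swung_cell_old (h : Replaceable σ q old new) {b : Addr} (hb : σ.cell b ≠ none)
    (hq : ∀ s, q ≠ .child b s) : (σ.swung q new).cell b = σ.cell b := by
  have h1 : (σ.alloc new).cell b = σ.cell b := by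
    simp [Mem.alloc, lookup_eq_none (h.not_mem_new hb)]
  unfold Mem.swung
  cases q with
  | root => exact h1
  | child a s =>
    have : b ≠ a := fun e => hq s (by rw [e])
    simp [Mem.write, Function.update_of_ne this, h1]

theorem swung_cell_new (h : Replaceable σ q old new) {e : Addr × Cell K} (he : e ∈ new.cells) :
    (σ.swung q new).cell e.1 = some e.2 := by
  have h1 : (σ.alloc new).cell e.1 = some e.2 := by
    simp [Mem.alloc, lookup_of_nodup h.distinct he]
  unfold Mem.swung
  cases hq : q with
  | root => exact h1
  | child a s =>
    obtain ⟨w, k, l, r, h2, -⟩ := h.owner hq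
    have : e.1 ≠ a := fun h3 => by
      have := h.fresh e he
      simp [h3, h2] at this
    simp [Mem.write, Function.update_of_ne this, h1]

open Classical in
theorem swung_cell_internal (h : Replaceable σ q old new) {b : Addr} {w : ℕ} {k : WithTop K}
    {l r : Addr} (hb : σ.cell b = some (.internal w k l r)) :
    (σ.swung q new).cell b = some (.internal w k
      (if q = .child b .left then new.addr else l)
      (if q = .child b .right then new.addr else r)) := by
  by_cases hq : ∃ s, q = .child b s
  · obtain ⟨s, rfl⟩ := hq
    have h1 : (σ.alloc new).cell b = σ.cell b := by
      simp [Mem.alloc, lookup_eq_none (h.not_mem_new (b := b) (by simp [hb]))]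
    cases s <;> simp [Mem.swung, Mem.write, h1, hb, Cell.setChild]
  · push Not at hq
    rw [h.swung_cell_old (by simp [hb]) hq, hb, if_neg (hq _), if_neg (hq _)]

theorem swung_cell_ne_none (h : Replaceable σ q old new) {b : Addr} (hb : σ.cell b ≠ none) :
    (σ.swung q new).cell b ≠ none := by
  by_cases hq : ∃ s, q = .child b s
  · obtain ⟨s, hs⟩ := hq
    obtain ⟨w, k, l, r, h2, -⟩ := h.owner hs
    simp [h.swung_cell_internal h2]
  · push Not at hq
    rwa [h.swung_cell_old hb hq]

theorem of_swung_cell_ne_none (h : Replaceable σ q old new) {b : Addr}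
    (hb : (σ.swung q new).cell b ≠ none) : σ.cell b ≠ none ∨ b ∈ new.addrs := by
  by_contra! hcon
  refine hb ?_
  have h1 : (σ.alloc new).cell b = none := by
    simp [Mem.alloc, lookup_eq_none hcon.2, hcon.1]
  unfold Mem.swung
  cases hq : q with
  | root => exact h1
  | child a s =>
    obtain ⟨w, k, l, r, h2, -⟩ := h.owner hq
    have : b ≠ a := fun h3 => by simp [← h3, hcon.1] at h2
    simp [Mem.write, Function.update_of_ne this, h1]

theorem swung_marked (σ : Mem K) (q : Slot) (new : Patch K) :
    (σ.swung q new).marked = σ.marked := by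
  cases q <;> rfl

theorem swung_root (σ : Mem K) (q : Slot) (new : Patch K) :
    (σ.swung q new).root = match q with | .root => new.addr | .child _ _ => σ.root := by
  cases q <;> rfl

variable [LinearOrder K]

/-- The complete tree below a piece. -/
noncomputable def _root_.Chromatic.Patch.expand (σ : Mem K) (p : Patch K) : Patch K :=
  p.fill (treeAt σ)

theorem expand_old (hσ : IsStructure σ) (h : Replaceable σ q old new) :
    (old.expand σ).addr = old.addr ∧ (old.expand σ).Closed ∧ (old.expand σ).In σ := by
  have hp := h.present.ptrs
  exact ⟨Patch.fill_addr fun b hb => (hσ.treeAt_spec (hp b hb)).1,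
    Patch.fill_closed fun b hb => (hσ.treeAt_spec (hp b hb)).2.1,
    Patch.fill_in h.present.cells fun b hb =>
      ⟨(hσ.treeAt_spec (hp b hb)).1, (hσ.treeAt_spec (hp b hb)).2.2⟩⟩

/-- By uniqueness the tree below the owner has the tree below `old` as a child, and finite trees
contain no cycles. This is why the write does not disturb the subtrees that `new` reuses. -/
theorem owner_not_mem_old (hσ : IsStructure σ) (h : Replaceable σ q old new) {a : Addr} {s : Side}
    (hq : q = .child a s) : a ∉ (old.expand σ).addrs := by
  obtain ⟨w, k, l, r, h1, h2⟩ := h.owner hq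
  obtain ⟨e1, e2, e3⟩ := h.expand_old hσ
  obtain ⟨t1, t2, t3⟩ := hσ.treeAt_spec (a := a) (by simp [h1])
  generalize treeAt σ a = t at *
  cases t with
  | ptr => exact t2.elim
  | leaf b v x =>
    obtain rfl : b = a := t1
    have := h1.symm.trans t3
    simp at this
  | node b v j L R =>
    obtain rfl : b = a := t1
    have e := h1.symm.trans t3.1
    simp only [Option.some.injEq, Cell.internal.injEq] at e
    obtain ⟨rfl, rfl, rfl, rfl⟩ := e
    cases s with
    | left =>
      obtain rfl := t3.2.1.unique e3 t2.1 e2 (h2.symm.trans e1.symm)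
      exact Patch.not_mem_addrs (c := ⟨b, w, k, .left, R⟩) (C := []) t3 t2
    | right =>
      obtain rfl := t3.2.2.unique e3 t2.2 e2 (h2.symm.trans e1.symm)
      exact Patch.not_mem_addrs (c := ⟨b, w, k, .right, L⟩) (C := []) t3 t2

theorem expand_new (hσ : IsStructure σ) (h : Replaceable σ q old new)
    (hp : new.ptrs ⊆ old.ptrs) :
    (new.expand σ).addr = new.addr ∧ (new.expand σ).Closed ∧
      (new.expand σ).In (σ.swung q new) := by
  have spec := fun b hb => hσ.treeAt_spec (h.present.ptrs b (hp hb))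
  refine ⟨Patch.fill_addr fun b hb => (spec b hb).1,
    Patch.fill_closed fun b hb => (spec b hb).2.1,
    Patch.fill_in (fun e he => h.swung_cell_new he) fun b hb => ⟨(spec b hb).1, ?_⟩⟩
  -- A subtree hanging from `new` also hangs from `old`, hence avoids the owner of `q`, and all its
  -- cells keep their contents.
  refine (spec b hb).2.2.congr (spec b hb).2.1 fun c hc => ?_
  refine h.swung_cell_old ((spec b hb).2.2.cell_ne_none_of_mem hc) ?_
  rintro s hs
  exact h.owner_not_mem_old hσ hs (Patch.mem_addrs_fill.2 (.inr ⟨b, hp hb, hc⟩))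

/-- The tree may start at any allocated cell, in particular at a removed one: this is what controls
paused iterators. -/
theorem redirect_in (hσ : IsStructure σ) (h : Replaceable σ q old new) (hp : new.ptrs ⊆ old.ptrs)
    {t : Patch K} (hc : t.Closed) (ht : t.In σ) :
    (t.redirect q (new.expand σ)).In (σ.swung q new) := by
  obtain ⟨n1, n2, n3⟩ := h.expand_new hσ hp
  induction t with
  | ptr => exact hc.elim
  | leaf a w x =>
    have ht : σ.cell a = some (.leaf w x) := ht
    refine Eq.trans (h.swung_cell_old (by simp [ht]) ?_) ht
    intro s hs
    obtain ⟨w, k, l, r, h2, -⟩ := h.owner hs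
    simp [h2] at ht
  | node a w k l r ihl ihr =>
    refine ⟨?_, ?_, ?_⟩
    · rw [h.swung_cell_internal ht.1]
      congr 2
      · split <;> simp [n1]
      · split <;> simp [n1]
    · split
      · exact n3
      · exact ihl hc.1 ht.2.1
    · split
      · exact n3
      · exact ihr hc.2 ht.2.2

theorem memory (hσ : IsStructure σ) (h : Replaceable σ q old new) (hp : new.ptrs ⊆ old.ptrs)
    {a : Addr} (ha : (σ.swung q new).cell a ≠ none) :
    ∃ t : Patch K, t.addr = a ∧ t.Closed ∧ t.In (σ.swung q new) := by
  obtain ⟨n1, n2, n3⟩ := h.expand_new hσ hp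
  rcases h.of_swung_cell_ne_none ha with ha | ha
  · obtain ⟨t1, t2, t3⟩ := hσ.treeAt_spec ha
    exact ⟨_, (Patch.redirect_addr _).trans t1, Patch.redirect_closed n2 t2,
      h.redirect_in hσ hp t2 t3⟩
  · obtain ⟨C, A, hA, hA'⟩ := Patch.exists_plug_of_mem_addrs
      (Patch.mem_addrs_fill (g := treeAt σ).2 (.inl ha))
    unfold Patch.expand at n2 n3
    rw [hA] at n2 n3
    exact ⟨A, hA', n2.of_plug, n3.of_plug⟩

-- Where the tree uses `q`, its subtree is the one below `old`, by uniqueness; elsewhere the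
-- recursion applies. The nodes of the right subtree are carried along for tasks of the form
-- `resume`.
open Classical in
theorem redirect_agree (hσ : IsStructure σ) (h : Replaceable σ q old new)
    {R : Set (KeyNode K)} (hR : AgreeOff R (old.expand σ).nodes (new.expand σ).nodes)
    {t : Patch K} (hc : t.Closed) (ht : t.In σ) :
    AgreeOff R t.nodes (t.redirect q (new.expand σ)).nodes ∧
      AgreeOff R t.rightNodes (t.redirect q (new.expand σ)).rightNodes := by
  obtain ⟨e1, e2, e3⟩ := h.expand_old hσ
  induction t with
  | ptr => exact hc.elim
  | leaf a w x => exact ⟨.refl _ _, .refl _ _⟩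
  | node a w k l r ihl ihr =>
    have hl : AgreeOff R l.nodes (if q = Slot.child a .left then new.expand σ
        else l.redirect q (new.expand σ)).nodes := by
      split
      · rename_i hq
        obtain ⟨w', k', l', r', h2, h3⟩ := h.owner hq
        have e := h2.symm.trans ht.1
        simp only [Option.some.injEq, Cell.internal.injEq] at e
        rwa [ht.2.1.unique e3 hc.1 e2 (e.2.2.1.symm.trans (h3.symm.trans e1.symm))]
      · exact (ihl hc.1 ht.2.1).1
    have hr : AgreeOff R r.nodes (if q = Slot.child a .right then new.expand σ
        else r.redirect q (new.expand σ)).nodes := by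
      split
      · rename_i hq
        obtain ⟨w', k', l', r', h2, h3⟩ := h.owner hq
        have e := h2.symm.trans ht.1
        simp only [Option.some.injEq, Cell.internal.injEq] at e
        rwa [ht.2.2.unique e3 hc.2 e2 (e.2.2.2.symm.trans (h3.symm.trans e1.symm))]
      · exact (ihr hc.2 ht.2.2).1
    refine ⟨?_, hr⟩
    rw [Patch.redirect, Patch.nodes_node, Patch.nodes_node]
    exact hl.append hr

/-- The views of paused iterators change at most by the key nodes in which the replaced and the
new piece differ. -/
theorem framesAgree (hσ : IsStructure σ) (h : Replaceable σ q old new) (hp : new.ptrs ⊆ old.ptrs)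
    {R : Set (KeyNode K)} (hR : AgreeOff R (old.expand σ).nodes (new.expand σ).nodes) :
    FramesAgree R σ (σ.swung q new) := by
  obtain ⟨e1, e2, e3⟩ := h.expand_old hσ
  obtain ⟨n1, n2, n3⟩ := h.expand_new hσ hp
  have key : ∀ a, σ.cell a ≠ none →
      treeAt (σ.swung q new) a = (treeAt σ a).redirect q (new.expand σ) := by
    intro a ha
    obtain ⟨t1, t2, t3⟩ := hσ.treeAt_spec ha
    exact treeAt_eq (Patch.redirect_closed n2 t2) (h.redirect_in hσ hp t2 t3)
      ((Patch.redirect_addr _).trans t1)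
  have agree := fun a (ha : σ.cell a ≠ none) =>
    h.redirect_agree hσ hR (hσ.treeAt_spec ha).2.1 (hσ.treeAt_spec ha).2.2
  refine ⟨fun a ha => h.swung_cell_ne_none ha, ?_, fun a ha => ?_, fun a ha => ?_⟩
  · unfold frameNodes
    rw [swung_root]
    cases q with
    -- The entry pointer is read only by the task `start`, and the whole tree is exchanged.
    | root =>
      have : σ.root = old.addr := by simpa [Slot.read] using h.points
      rwa [treeAt_eq e2 e3 (e1.trans this.symm), treeAt_eq n2 n3 n1]
    | child b s =>
      simp only
      rw [key _ hσ.root_ne_none]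
      exact (agree _ hσ.root_ne_none).1
  · simp only [frameNodes]
    rw [key a ha]
    exact (agree a ha).1
  · simp only [frameNodes]
    rw [key a ha]
    exact (agree a ha).2

/-! ### The position of the redirected pointer in the current tree -/

theorem _root_.Chromatic.Patch.IsWholeTree.search {t : Patch K} (h : t.IsWholeTree) :
    t.IsSearchTree := by
  obtain ⟨a, w, rfl⟩ | ⟨a, w, c, b, v, rfl, hc⟩ := h
  · trivial
  · refine ⟨fun x hx => ?_, fun x hx => ?_, hc.search, trivial⟩
    · cases x with
      | none => exact absurd rfl (hc.noSentinel _ hx)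
      | some N => exact WithTop.coe_lt_top _
    · obtain rfl : x = none := by simpa [Patch.leaves] using hx
      exact le_rfl

theorem _root_.Chromatic.OnSearchPath.exists_plug {t : Patch K} (h0 : t.addr = σ.root)
    (hc : t.Closed) (ht : t.In σ) {u : KeyNode K} {b : Addr} (h : OnSearchPath σ u.key b) :
    ∃ C A, t = Patch.plug C A ∧ A.addr = b ∧ ∀ c ∈ C, c.Admits (some u) := by
  induction h with
  | root => exact ⟨[], t, rfl, h0, by simp⟩
  | @left a w k l r h e hk ih =>
    obtain ⟨C, A, rfl, rfl, hC⟩ := ih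
    have hA := ht.of_plug
    cases A with
    | ptr => exact hc.of_plug.elim
    | leaf a v x => exact absurd (e.symm.trans hA) (by simp)
    | node a v j L R =>
      have := e.symm.trans hA.1
      simp only [Option.some.injEq, Cell.internal.injEq] at this
      refine ⟨C ++ [⟨a, v, j, .left, R⟩], L, by simp [Patch.plug_append, Crumb.fill],
        this.2.2.1.symm, ?_⟩
      intro c hc
      rcases List.mem_append.1 hc with hc | hc
      · exact hC c hc
      · obtain rfl := List.mem_singleton.1 hc
        exact this.2.1 ▸ hk
  | @right a w k l r h e hk ih =>
    obtain ⟨C, A, rfl, rfl, hC⟩ := ih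
    have hA := ht.of_plug
    cases A with
    | ptr => exact hc.of_plug.elim
    | leaf a v x => exact absurd (e.symm.trans hA) (by simp)
    | node a v j L R =>
      have := e.symm.trans hA.1
      simp only [Option.some.injEq, Cell.internal.injEq] at this
      refine ⟨C ++ [⟨a, v, j, .right, L⟩], R, by simp [Patch.plug_append, Crumb.fill],
        this.2.2.2.symm, ?_⟩
      intro c hc
      rcases List.mem_append.1 hc with hc | hc
      · exact hC c hc
      · obtain rfl := List.mem_singleton.1 hc
        exact this.2.1 ▸ hk

/-- Redirecting the pointer at the end of a path in a search tree changes the tree only there. -/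
theorem _root_.Chromatic.Patch.redirect_plug {C : List (Crumb K)} {c : Crumb K} {O N : Patch K}
    (hc : (Patch.plug (C ++ [c]) O).Closed) (ht : (Patch.plug (C ++ [c]) O).In σ)
    (hs : (Patch.plug (C ++ [c]) O).IsSearchTree) :
    (Patch.plug (C ++ [c]) O).redirect (.child c.addr c.side) N = Patch.plug (C ++ [c]) N := by
  induction C with
  | nil =>
    -- The sibling is regarded as the hole, with the side reversed and `O` as the new sibling.
    have h1 : c.addr ∉ c.sibling.addrs := by
      obtain ⟨a, w, k, s, p⟩ := c
      cases s
      · exact Patch.not_mem_addrs (c := ⟨a, w, k, .right, O⟩) (C := []) ht hc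
      · exact Patch.not_mem_addrs (c := ⟨a, w, k, .left, O⟩) (C := []) ht hc
    have h2 : c.sibling.redirect (.child c.addr c.side) N = c.sibling := by
      refine Patch.redirect_eq_self fun a s hq => ?_
      cases hq
      exact h1
    obtain ⟨a, w, k, s, p⟩ := c
    cases s <;> simpa [Patch.redirect, Crumb.fill] using h2
  | cons d C ih =>
    have ih := ih hc.of_fill.1 ht.of_fill.1 hs.of_fill
    obtain ⟨B, hB, hB'⟩ : ∃ B : Patch K, c.addr = B.addr ∧ Patch.plug (C ++ [c]) O =
        Patch.plug C B := by
      refine ⟨c.fill O, ?_, by simp [Patch.plug_append]⟩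
      obtain ⟨a, w, k, s, p⟩ := c
      cases s <;> rfl
    rw [List.cons_append, Patch.plug_cons, hB'] at hc ht hs
    have hBc := hc.of_fill.1.of_plug
    have hBi := ht.of_fill.1.of_plug
    -- Otherwise the tree below the owner would occur on both sides of `d`. Only the search order
    -- excludes such sharing of cells.
    have h1 : c.addr ∉ d.sibling.addrs := by
      intro hm
      obtain ⟨D, A, hA, hA'⟩ := Patch.exists_plug_of_mem_addrs hm
      have sc := hc.of_fill.2
      have si := ht.of_fill.2
      rw [hA] at sc si
      obtain rfl := si.of_plug.unique hBi sc.of_plug hBc (hA'.trans hB)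
      obtain ⟨x, hx⟩ := List.exists_mem_of_ne_nil _ hBc.leaves_ne_nil
      have x1 := Patch.leaves_subset_plug C _ hx
      have x2 := Patch.leaves_subset_plug D _ hx
      obtain ⟨a, w, k, s, p⟩ := d
      obtain rfl : p = _ := hA
      cases s
      · exact hs.not_both x1 x2
      · exact hs.not_both x2 x1
    have h2 : d.sibling.redirect (.child c.addr c.side) N = d.sibling := by
      refine Patch.redirect_eq_self fun a s hq => ?_
      cases hq
      exact h1
    have h3 : c.addr ≠ d.addr := by
      intro e
      have e2 : B = d.fill (Patch.plug C B) := by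
        refine hBi.unique ht hBc hc ?_
        rw [← hB, e]
        obtain ⟨a, w, k, s, p⟩ := d
        cases s <;> rfl
      exact Patch.plug_ne_self (c := d) (C := C) hc e2.symm
    obtain ⟨a, w, k, s, p⟩ := d
    cases s <;> simp_all [Patch.redirect, Crumb.fill]

/-- The pointer `q` is at the lower end of the path `C`. -/
def _root_.Chromatic.Slot.EndsPath (q : Slot) (C : List (Crumb K)) : Prop :=
  (q = .root ∧ C = []) ∨ ∃ D c, C = D ++ [c] ∧ q = .child c.addr c.side

/-- In the current tree, the tree below the old piece is replaced by the tree below the new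
piece. -/
theorem exists_plug (hσ : IsStructure σ) (h : Replaceable σ q old new)
    (hp : new.ptrs ⊆ old.ptrs) :
    ∃ C : List (Crumb K), (Patch.plug C (old.expand σ)).IsWholeTree ∧
      (Patch.plug C (old.expand σ)).addr = σ.root ∧
      (Patch.plug C (old.expand σ)).In σ ∧
      (Patch.plug C (new.expand σ)).addr = (σ.swung q new).root ∧
      (Patch.plug C (new.expand σ)).In (σ.swung q new) ∧ q.EndsPath C := by
  obtain ⟨e1, e2, e3⟩ := h.expand_old hσ
  obtain ⟨n1, n2, n3⟩ := h.expand_new hσ hp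
  obtain ⟨t, t1, t2, t3⟩ := hσ.tree
  cases hq : q with
  | root =>
    subst hq
    have : σ.root = old.addr := by simpa [Slot.read] using h.points
    obtain rfl := t2.unique e3 t3.closed e2 (t1.trans (this.trans e1.symm))
    exact ⟨[], t3, t1, t2, n1, n3, .inl ⟨rfl, rfl⟩⟩
  | child a s =>
    have hl : Live σ a := by
      have := h.live
      rwa [hq] at this
    obtain ⟨D, A, rfl, rfl⟩ := hl.exists_plug t1 t3.closed t2
    obtain ⟨w, k, l, r, h1, h2⟩ := h.owner hq
    have hAc := t3.closed.of_plug
    have hA := t2.of_plug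
    -- The subtree of the owner is its crumb filled with the tree below `old`, so the path to the
    -- owner is extended by one crumb.
    obtain ⟨c, rfl, hca, hcs⟩ : ∃ c : Crumb K, A = c.fill (old.expand σ) ∧
        c.addr = A.addr ∧ c.side = s := by
      cases A with
      | ptr => exact hAc.elim
      | leaf a v x => exact absurd (h1.symm.trans hA) (by simp)
      | node a v j L R =>
        have := h1.symm.trans hA.1
        simp only [Option.some.injEq, Cell.internal.injEq] at this
        cases s with
        | left =>
          refine ⟨⟨a, v, j, .left, R⟩, ?_, rfl, rfl⟩
          rw [hA.2.1.unique e3 hAc.1 e2 (this.2.2.1.symm.trans (h2.symm.trans e1.symm))]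
          rfl
        | right =>
          refine ⟨⟨a, v, j, .right, L⟩, ?_, rfl, rfl⟩
          rw [hA.2.2.unique e3 hAc.2 e2 (this.2.2.2.symm.trans (h2.symm.trans e1.symm))]
          rfl
    have hD : ∀ t, Patch.plug D (c.fill t) = Patch.plug (D ++ [c]) t := fun t => by
      simp [Patch.plug_append]
    rw [hD] at t1 t2 t3
    rw [← hca, ← hcs] at hq
    rw [← hca, ← hcs, ← hq]
    have key := Patch.redirect_plug (N := new.expand σ) t3.closed t2 t3.search
    rw [← hq] at key
    refine ⟨D ++ [c], t3, t1, t2, ?_, ?_, .inr ⟨D, c, rfl, hq⟩⟩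
    · rw [← key, Patch.redirect_addr, t1, swung_root, hq]
    · rw [← key]
      exact h.redirect_in hσ hp t3.closed t2

end Replaceable

namespace Patch

/-! ### Weights and mirror images -/

@[simp] theorem leaves_setWeight (v : ℕ) (t : Patch K) : (t.setWeight v).leaves = t.leaves := by
  cases t <;> rfl

@[simp] theorem nodes_setWeight (v : ℕ) (t : Patch K) : (t.setWeight v).nodes = t.nodes := by
  simp [nodes]

@[simp] theorem ptrs_setWeight (v : ℕ) (t : Patch K) : (t.setWeight v).ptrs = t.ptrs := by
  cases t <;> rfl

theorem setWeight_closed {v : ℕ} {t : Patch K} : (t.setWeight v).Closed ↔ t.Closed := by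
  cases t <;> rfl

theorem setWeight_search [LinearOrder K] {v : ℕ} {t : Patch K} :
    (t.setWeight v).IsSearchTree ↔ t.IsSearchTree := by
  cases t <;> rfl

theorem LeavesPositive.setWeight {v : ℕ} {t : Patch K} (h : t.LeavesPositive) (hv : 1 ≤ v) :
    (t.setWeight v).LeavesPositive := by
  cases t
  · trivial
  · exact hv
  · exact h

theorem PathWeight.setWeight {v h : ℕ} {t : Patch K} (ht : t.PathWeight h) :
    ∃ h', (t.setWeight v).PathWeight h' := by
  cases t with
  | ptr => exact ht.elim
  | leaf => exact ⟨v, rfl⟩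
  | node =>
    obtain ⟨g, -, hl, hr⟩ := ht
    exact ⟨v + g, g, rfl, hl, hr⟩

theorem fill_setWeight {t : Patch K} (ht : ∀ e, t ≠ ptr e) (g : Addr → Patch K) (v : ℕ) :
    (t.setWeight v).fill g = (t.fill g).setWeight v := by
  cases t with
  | ptr e => exact absurd rfl (ht e)
  | leaf => rfl
  | node => rfl

/-- A bare pointer is excluded because its copy is itself, whereas the tree put in its place would
be copied. -/
theorem fill_copy {t : Patch K} (ht : ∀ e, t ≠ ptr e) (g : Addr → Patch K) (b v : ℕ) :
    (t.copy b v).fill g = (t.fill g).copy b v := by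
  cases t with
  | ptr e => exact absurd rfl (ht e)
  | leaf => rfl
  | node => rfl

theorem fill_weight {t : Patch K} (ht : ∀ e, t ≠ ptr e) (g : Addr → Patch K) :
    (t.fill g).weight = t.weight := by
  cases t with
  | ptr e => exact absurd rfl (ht e)
  | leaf => rfl
  | node => rfl

theorem ptrs_copy {t : Patch K} (ht : ∀ e, t ≠ ptr e) (b v : ℕ) : (t.copy b v).ptrs = t.ptrs := by
  cases t with
  | ptr e => exact absurd rfl (ht e)
  | leaf => rfl
  | node => rfl

theorem ne_ptr_of_weight {t : Patch K} {v : ℕ} (h : v < t.weight) : ∀ e, t ≠ ptr e := by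
  rintro e rfl
  exact absurd h (Nat.not_lt_zero v)

@[simp] theorem leaves_copy (b v : ℕ) (t : Patch K) : (t.copy b v).leaves = t.leaves := by
  cases t <;> rfl

theorem copy_closed {b v : ℕ} {t : Patch K} : (t.copy b v).Closed ↔ t.Closed := by
  cases t <;> rfl

theorem copy_search [LinearOrder K] {b v : ℕ} {t : Patch K} :
    (t.copy b v).IsSearchTree ↔ t.IsSearchTree := by
  cases t <;> rfl

theorem LeavesPositive.copy {b v : ℕ} {t : Patch K} (h : t.LeavesPositive) (hv : t.weight ≤ v) :
    (t.copy b v).LeavesPositive := by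
  cases t
  · trivial
  · exact le_trans (b := _) h hv
  · exact h

theorem copy_positive_iff {b : ℕ} {t : Patch K} (ht : 1 < t.weight) :
    (t.copy b (t.weight - 1)).LeavesPositive ↔ t.LeavesPositive := by
  cases t with
  | ptr => rfl
  | leaf a w x =>
    simp only [weight] at ht
    simp only [copy, weight, LeavesPositive]
    omega
  | node => rfl

theorem PathWeight.copy_add {b w h : ℕ} {t : Patch K} (ht : t.PathWeight h) :
    (t.copy b (w + t.weight)).PathWeight (w + h) := by
  cases t with
  | ptr => exact ht.elim
  | leaf a v x =>
    obtain rfl : h = v := ht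
    rfl
  | node a v k l r =>
    obtain ⟨g, rfl, hl, hr⟩ := ht
    exact ⟨g, by simp [weight, Nat.add_assoc], hl, hr⟩

theorem mirror_mirror (t : Patch K) : t.mirror.mirror = t := by
  induction t with
  | ptr => rfl
  | leaf => rfl
  | node a w k l r ihl ihr => simp [mirror, ihl, ihr]

theorem mirror_closed {t : Patch K} : t.mirror.Closed ↔ t.Closed := by
  induction t with
  | ptr => rfl
  | leaf => rfl
  | node a w k l r ihl ihr => exact (and_congr ihr ihl).trans and_comm

theorem mirror_positive {t : Patch K} : t.mirror.LeavesPositive ↔ t.LeavesPositive := by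
  induction t with
  | ptr => rfl
  | leaf => rfl
  | node a w k l r ihl ihr => exact (and_congr ihr ihl).trans and_comm

theorem mirror_pathWeight {t : Patch K} {h : ℕ} : t.mirror.PathWeight h ↔ t.PathWeight h := by
  induction t generalizing h with
  | ptr => rfl
  | leaf => rfl
  | node a w k l r ihl ihr =>
    exact exists_congr fun g => and_congr_right' ((and_congr ihr ihl).trans and_comm)

theorem mirror_ptrs (t : Patch K) : t.mirror.ptrs = t.ptrs.reverse := by
  induction t with
  | ptr => rfl
  | leaf => rfl
  | node a w k l r ihl ihr => simp [mirror, ptrs, ihl, ihr]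

theorem mirror_fill (t : Patch K) (g : Addr → Patch K) :
    (t.fill g).mirror = t.mirror.fill fun a => (g a).mirror := by
  induction t with
  | ptr => rfl
  | leaf => rfl
  | node a w k l r ihl ihr => simp [mirror, fill, ihl, ihr]

/-- The weights of the paths to the leaves, from left to right. -/
def depths : Patch K → List ℕ
  | ptr _ => []
  | leaf _ w _ => [w]
  | node _ w _ l r => (l.depths ++ r.depths).map (w + ·)

theorem Closed.depths_ne_nil {t : Patch K} (h : t.Closed) : t.depths ≠ [] := by
  induction t with
  | ptr => exact h.elim
  | leaf => simp [depths]
  | node a w k l r ihl ihr => simp [depths, ihl h.1]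

/-- With this, balance under a rotation reduces to an equality of lists. -/
theorem Closed.pathWeight_iff {t : Patch K} (hc : t.Closed) {h : ℕ} :
    t.PathWeight h ↔ ∀ d ∈ t.depths, d = h := by
  induction t generalizing h with
  | ptr => exact hc.elim
  | leaf => simp [PathWeight, depths, eq_comm]
  | node a w k l r ihl ihr =>
    simp only [PathWeight, ihl hc.1, ihr hc.2, depths, List.mem_map, List.mem_append,
      forall_exists_index, and_imp, forall_apply_eq_imp_iff₂]
    constructor
    · rintro ⟨g, rfl, hl, hr⟩ d (hd | hd)
      · rw [hl d hd]
      · rw [hr d hd]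
    · intro H
      -- The weight below the topmost cell is read off at some leaf of the left subtree.
      obtain ⟨g, hg⟩ := List.exists_mem_of_ne_nil _ hc.1.depths_ne_nil
      have := H g (.inl hg)
      exact ⟨g, this.symm, fun d hd => by have := H d (.inl hd); omega,
        fun d hd => by have := H d (.inr hd); omega⟩

/-- Naming the reduced list `D` and recovering the original by adding one avoids truncated
subtraction in the rules. -/
theorem depths_copy {t : Patch K} (ht : 1 < t.weight) :
    ∃ D : List ℕ, t.depths = D.map (1 + ·) ∧ ∀ b, (t.copy b (t.weight - 1)).depths = D := by
  cases t with
  | ptr => exact absurd ht (Nat.not_lt_zero 1)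
  | leaf a w x =>
    simp only [weight] at ht
    exact ⟨[w - 1], by simp only [depths, List.map_cons, List.map_nil]; congr 1; omega,
      fun b => rfl⟩
  | node a w k l r =>
    simp only [weight] at ht
    refine ⟨_, ?_, fun b => rfl⟩
    simp only [depths, weight, List.map_map]
    congr 1
    funext d
    simp only [Function.comp_apply]
    omega

/-! ### Rotations -/

/-- The trees differ by rotations, and by the addresses and weights of their cells. -/
inductive Reshape : Patch K → Patch K → Prop
  | leaf {a w a' w' : ℕ} {x : Option (KeyNode K)} : Reshape (leaf a w x) (leaf a' w' x)
  | node {a w a' w' : ℕ} {k : WithTop K} {l r l' r' : Patch K} (hl : Reshape l l')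
      (hr : Reshape r r') : Reshape (node a w k l r) (node a' w' k l' r')
  | rot {x w y v x' w' y' v' : ℕ} {k i : WithTop K} {a b c : Patch K} (hb : b.Closed) :
      Reshape (node x w k (node y v i a b) c) (node x' w' i a (node y' v' k b c))
  | refl (t : Patch K) : Reshape t t
  | symm {p q : Patch K} (h : Reshape p q) : Reshape q p
  | trans {p q r : Patch K} (h : Reshape p q) (h' : Reshape q r) : Reshape p r

namespace Reshape

theorem leaves_eq {p q : Patch K} (h : Reshape p q) : p.leaves = q.leaves := by
  induction h with
  | leaf => rfl
  | node hl hr ihl ihr => simp [leaves, ihl, ihr]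
  | rot hb => simp [leaves]
  | refl => rfl
  | symm _ ih => exact ih.symm
  | trans _ _ ih ih' => exact ih.trans ih'

theorem search_iff [LinearOrder K] {p q : Patch K} (h : Reshape p q) :
    p.IsSearchTree ↔ q.IsSearchTree := by
  induction h with
  | leaf => rfl
  | node hl hr ihl ihr => simp only [IsSearchTree, hl.leaves_eq, hr.leaves_eq, ihl, ihr]
  | @rot x w y v x' w' y' v' k i a b c hb =>
    -- The two routing keys are compared through a leaf of the middle subtree; this is why a
    -- rotation requires that subtree to be complete.
    obtain ⟨z, hz⟩ := List.exists_mem_of_ne_nil _ hb.leaves_ne_nil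
    simp only [IsSearchTree, leaves, List.mem_append]
    constructor
    · rintro ⟨h1, h2, ⟨h3, h4, h5, h6⟩, h7⟩
      refine ⟨h3, ?_, h5, fun x hx => h1 x (.inr hx), h2, h6, h7⟩
      rintro x (hx | hx)
      · exact h4 x hx
      · exact ((h4 z hz).trans (h1 z (.inr hz)).le).trans (h2 x hx)
    · rintro ⟨h1, h2, h3, h4, h5, h6, h7⟩
      refine ⟨?_, h5, ⟨h1, fun x hx => h2 x (.inl hx), h3, h6⟩, h7⟩
      rintro x (hx | hx)
      · exact ((h1 x hx).trans_le (h2 z (.inl hz))).trans (h4 z hz)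
      · exact h4 x hx
  | refl => rfl
  | symm _ ih => exact ih.symm
  | trans _ _ ih ih' => exact ih.trans ih'

/-- The mirror image of a rotation is a rotation in the opposite direction, which the closure under
symmetry supplies. -/
theorem mirror {p q : Patch K} (h : Reshape p q) : Reshape p.mirror q.mirror := by
  induction h with
  | leaf => exact .leaf
  | node _ _ ihl ihr => exact .node ihr ihl
  | rot hb => exact .symm (.rot (mirror_closed.2 hb))
  | refl => exact .refl _
  | symm _ ih => exact ih.symm
  | trans _ _ ih ih' => exact ih.trans ih'

theorem copy (b v : ℕ) (t : Patch K) : Reshape t (t.copy b v) := by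
  cases t with
  | ptr => exact .refl _
  | leaf => exact .leaf
  | node => exact .node (.refl _) (.refl _)

end Reshape

end Patch

open Patch

theorem Rule.ptrs_eq {r : RotationName} {old new : Patch K} (h : Rule r old new) :
    new.ptrs = old.ptrs := by
  have key : ∀ (U : Patch K) (b : ℕ), 1 < U.weight → (U.copy b (U.weight - 1)).ptrs = U.ptrs :=
    fun U b hU => ptrs_copy (ne_ptr_of_weight hU) _ _
  cases h <;> simp [ptrs, *]

/-- Each rule takes at most three elementary rotations. The zero addresses and weights in the
intermediate trees are arbitrary, since `Reshape` ignores them. -/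
theorem Rule.reshape {r : RotationName} {old new : Patch K} (h : Rule r old new)
    {g : Addr → Patch K} (hg : ∀ b ∈ old.ptrs, (g b).Closed) :
    Reshape (old.fill g) (new.fill g) := by
  have hc : (old.fill g).Closed := fill_closed hg
  cases h with
  | BLK => exact .node (.node (.refl _) (.refl _)) (.node (.refl _) (.refl _))
  | RB1 x y x1 y1 w a b c k i => exact .rot hc.1.2
  | RB2 x y z x1 y1 z1 w a b c d k i j =>
    exact .trans (q := .node 0 0 k (.node 0 0 j (.node 0 0 i (g a) (g b)) (g c)) (g d))
      (.node (.symm (.rot hc.1.2.1)) (.refl _))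
      (.trans (q := .node 0 0 j (.node 0 0 i (g a) (g b)) (.node 0 0 k (g c) (g d)))
        (.rot hc.1.2.2) (.node (.node (.refl _) (.refl _)) (.node (.refl _) (.refl _))))
  | PUSH x z x1 u1 z1 w c d k j U hU =>
    simp only [fill, fill_copy (ne_ptr_of_weight hU)]
    exact .node (.copy _ _ _) (.node (.refl _) (.refl _))
  | W1 x z x1 z1 u1 v1 w d k j U V hU hV =>
    simp only [fill, fill_copy (ne_ptr_of_weight hU), fill_copy (ne_ptr_of_weight hV)]
    exact .trans (q := .node 0 0 j (.node 0 0 k (U.fill g) (V.fill g)) (g d))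
      (.symm (.rot hc.2.1)) (.node (.node (.copy _ _ _) (.copy _ _ _)) (.refl _))
  | W2 x y z x1 y1 z1 u1 w b c d k i j U hU =>
    simp only [fill, fill_copy (ne_ptr_of_weight hU)]
    exact .trans (q := .node 0 0 j (.node 0 0 k (U.fill g) (.node y 1 i (g b) (g c))) (g d))
      (.symm (.rot hc.2.1))
      (.node (.node (.copy _ _ _) (.node (.refl _) (.refl _))) (.refl _))
  | W3 x y z v x1 y1 z1 v1 u1 w a b c d k i j h U hU =>
    simp only [fill, fill_copy (ne_ptr_of_weight hU)]
    refine .trans (q := .node 0 0 j (.node 0 0 k (U.fill g)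
      (.node y 1 i (.node v 0 h (g a) (g b)) (g c))) (g d)) (.symm (.rot hc.2.1)) ?_
    refine .node (.trans (q := .node 0 0 k (U.fill g)
      (.node 0 0 h (g a) (.node 0 0 i (g b) (g c)))) (.node (.refl _) (.rot hc.2.1.1.2)) ?_)
      (.refl _)
    exact .trans (q := .node 0 0 h (.node 0 0 k (U.fill g) (g a)) (.node 0 0 i (g b) (g c)))
      (.symm (.rot hc.2.1.1.1))
      (.node (.node (.copy _ _ _) (.refl _)) (.node (.refl _) (.refl _)))
  | W4 x y z v x1 y1 z1 v1 u1 w a b c d k i j h U hU =>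
    simp only [fill, fill_copy (ne_ptr_of_weight hU)]
    refine .trans (q := .node 0 0 k (U.fill g)
      (.node 0 0 i (g a) (.node 0 0 j (.node v 0 h (g b) (g c)) (g d))))
      (.node (.refl _) (.rot hc.2.1.2)) ?_
    exact .trans (q := .node 0 0 i (.node 0 0 k (U.fill g) (g a))
      (.node 0 0 j (.node v 0 h (g b) (g c)) (g d))) (.symm (.rot hc.2.1.1))
      (.node (.node (.copy _ _ _) (.refl _))
        (.node (.node (.refl _) (.refl _)) (.refl _)))
  | W5 x y z x1 y1 z1 u1 w a b c k i j U hU =>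
    simp only [fill, fill_copy (ne_ptr_of_weight hU)]
    exact .trans (q := .node 0 0 j (.node 0 0 k (U.fill g) (g c)) (.node y 0 i (g a) (g b)))
      (.symm (.rot hc.2.1))
      (.node (.node (.copy _ _ _) (.refl _)) (.node (.refl _) (.refl _)))
  | W6 x y z x1 y1 z1 u1 w a b d k i j U hU =>
    simp only [fill, fill_copy (ne_ptr_of_weight hU)]
    refine .trans (q := .node 0 0 k (U.fill g) (.node 0 0 i (g a) (.node 0 0 j (g b) (g d))))
      (.node (.refl _) (.rot hc.2.1.2)) ?_
    exact .trans (q := .node 0 0 i (.node 0 0 k (U.fill g) (g a)) (.node 0 0 j (g b) (g d)))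
      (.symm (.rot hc.2.1.1))
      (.node (.node (.copy _ _ _) (.refl _)) (.node (.refl _) (.refl _)))
  | W7 x x1 u1 v1 w k U V hU hV =>
    simp only [fill, fill_copy (ne_ptr_of_weight hU), fill_copy (ne_ptr_of_weight hV)]
    exact .node (.copy _ _ _) (.copy _ _ _)

theorem fill_reduced {U : Patch K} (hU : 1 < U.weight) (g : Addr → Patch K) :
    (∃ D : List ℕ, (U.fill g).depths = D.map (1 + ·) ∧
      ∀ b, ((U.copy b (U.weight - 1)).fill g).depths = D) ∧
    ∀ b, ((U.copy b (U.weight - 1)).fill g).LeavesPositive ↔ (U.fill g).LeavesPositive := by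
  have hw := fill_weight (ne_ptr_of_weight hU) g
  simp only [fill_copy (ne_ptr_of_weight hU), ← hw]
  rw [← hw] at hU
  exact ⟨depths_copy hU, fun b => copy_positive_iff hU⟩

theorem Rule.depths_eq {r : RotationName} {old new : Patch K} (h : Rule r old new)
    (g : Addr → Patch K) : (new.fill g).depths = (old.fill g).depths := by
  -- Normal form for a unit of weight moved between a cell and its children.
  have swap : ∀ w : ℕ, (fun d => w + (1 + d)) = fun d => w + 1 + d := fun w => by
    funext d; omega
  cases h with
  | BLK | RB1 | RB2 => simp [fill, depths, Function.comp_def, swap]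
  | PUSH x z x1 u1 z1 w c d k j U hU
  | W2 x y z x1 y1 z1 u1 w b c d k i j U hU
  | W3 x y z v x1 y1 z1 v1 u1 w a b c d k i j h U hU
  | W4 x y z v x1 y1 z1 v1 u1 w a b c d k i j h U hU
  | W5 x y z x1 y1 z1 u1 w a b c k i j U hU
  | W6 x y z x1 y1 z1 u1 w a b d k i j U hU =>
    obtain ⟨⟨D, h1, h2⟩, -⟩ := fill_reduced hU g
    simp [fill, depths, Function.comp_def, swap, h1, h2]
  | W1 x z x1 z1 u1 v1 w d k j U V hU hV
  | W7 x x1 u1 v1 w k U V hU hV =>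
    obtain ⟨⟨D, h1, h2⟩, -⟩ := fill_reduced hU g
    obtain ⟨⟨E, h3, h4⟩, -⟩ := fill_reduced hV g
    simp [fill, depths, Function.comp_def, swap, h1, h2, h3, h4]

theorem Rule.positive_iff {r : RotationName} {old new : Patch K} (h : Rule r old new)
    (g : Addr → Patch K) : (old.fill g).LeavesPositive ↔ (new.fill g).LeavesPositive := by
  cases h with
  | BLK | RB1 | RB2 => simp [fill, LeavesPositive, and_assoc]
  | PUSH x z x1 u1 z1 w c d k j U hU
  | W2 x y z x1 y1 z1 u1 w b c d k i j U hU
  | W3 x y z v x1 y1 z1 v1 u1 w a b c d k i j h U hU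
  | W4 x y z v x1 y1 z1 v1 u1 w a b c d k i j h U hU
  | W5 x y z x1 y1 z1 u1 w a b c k i j U hU
  | W6 x y z x1 y1 z1 u1 w a b d k i j U hU =>
    simp [fill, LeavesPositive, and_assoc, (fill_reduced hU g).2]
  | W1 x z x1 z1 u1 v1 w d k j U V hU hV
  | W7 x x1 u1 v1 w k U V hU hV =>
    simp [fill, LeavesPositive, and_assoc, (fill_reduced hU g).2, (fill_reduced hV g).2]

/-! ### Equivalence of the trees before and after a rotation -/

/-- The trees have the same leaves in the same order, up to their weights, and the same path
weights. -/
structure Patch.Equivalent (p q : Patch K) : Prop where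
  reshape : Reshape p q
  closed : p.Closed ↔ q.Closed
  pathWeight : ∀ h, p.PathWeight h ↔ q.PathWeight h
  positive : p.LeavesPositive ↔ q.LeavesPositive

theorem Patch.Equivalent.symm {p q : Patch K} (h : Equivalent p q) : Equivalent q p :=
  ⟨h.reshape.symm, h.closed.symm, fun n => (h.pathWeight n).symm, h.positive.symm⟩

/-- The search property is not invariant under mirroring, but `Reshape` is; the search property is
derived only after the reflection has been undone. -/
theorem Patch.Equivalent.of_mirror {p q : Patch K} (h : Equivalent p.mirror q.mirror) :
    Equivalent p q := by
  refine ⟨?_, ?_, fun n => ?_, ?_⟩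
  · simpa [mirror_mirror] using h.reshape.mirror
  · simpa [mirror_closed] using h.closed
  · simpa [mirror_pathWeight] using h.pathWeight n
  · simpa [mirror_positive] using h.positive

theorem Rule.equivalent {r : RotationName} {old new : Patch K} (h : Rule r old new)
    {g : Addr → Patch K} (hg : ∀ b ∈ old.ptrs, (g b).Closed) :
    Equivalent (old.fill g) (new.fill g) := by
  have ho : (old.fill g).Closed := fill_closed hg
  have hn : (new.fill g).Closed := fill_closed (h.ptrs_eq ▸ hg)
  exact ⟨h.reshape hg, iff_of_true ho hn,
    fun n => by rw [ho.pathWeight_iff, hn.pathWeight_iff, h.depths_eq g], h.positive_iff g⟩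

theorem Oriented.ptrs_eq {r : RotationName} {m : Bool} {old new : Patch K}
    (h : Oriented r m old new) : new.ptrs = old.ptrs := by
  cases m with
  | false => exact Rule.ptrs_eq (r := r) (by simpa [Oriented] using h)
  | true =>
    have := Rule.ptrs_eq (r := r) (old := old.mirror) (new := new.mirror)
      (by simpa [Oriented] using h)
    simpa [mirror_ptrs] using this

theorem Oriented.equivalent {r : RotationName} {m : Bool} {old new : Patch K}
    (h : Oriented r m old new) {g : Addr → Patch K} (hg : ∀ b ∈ old.ptrs, (g b).Closed) :
    Equivalent (old.fill g) (new.fill g) := by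
  cases m with
  | false => exact Rule.equivalent (r := r) (by simpa [Oriented] using h) hg
  | true =>
    refine .of_mirror ?_
    rw [mirror_fill, mirror_fill]
    exact Rule.equivalent (r := r) (by simpa [Oriented] using h)
      fun b hb => mirror_closed.2 (hg b (by simpa [mirror_ptrs] using hb))

theorem Rule.exists_node {r : RotationName} {old new : Patch K} (h : Rule r old new) :
    (∃ a w k l r, old = .node a w k l r) ∧ ∃ a w k l r, new = .node a w k l r := by
  cases h <;> exact ⟨⟨_, _, _, _, _, rfl⟩, ⟨_, _, _, _, _, rfl⟩⟩

theorem exists_node_of_mirror {p : Patch K} (h : ∃ a w k l r, p.mirror = .node a w k l r) :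
    ∃ a w k l r, p = .node a w k l r := by
  obtain ⟨a, w, k, l, r, h⟩ := h
  exact ⟨a, w, k, r.mirror, l.mirror, by rw [← mirror_mirror p, h]; rfl⟩

theorem Oriented.exists_node {r : RotationName} {m : Bool} {old new : Patch K}
    (h : Oriented r m old new) :
    (∃ a w k l r, old = .node a w k l r) ∧ ∃ a w k l r, new = .node a w k l r := by
  cases m with
  | false => exact Rule.exists_node (r := r) (by simpa [Oriented] using h)
  | true =>
    have := Rule.exists_node (r := r) (old := old.mirror) (new := new.mirror)
      (by simpa [Oriented] using h)
    exact ⟨exists_node_of_mirror this.1, exists_node_of_mirror this.2⟩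

theorem Rotation.Rel.spec {ρ : Rotation} {old new : Patch K} (h : ρ.Rel old new)
    {g : Addr → Patch K} (hg : ∀ b ∈ old.ptrs, (g b).Closed) :
    Equivalent (old.fill g) (new.fill g) ∧ new.ptrs = old.ptrs ∧
      (∃ a w k l r, old = .node a w k l r) ∧ ∃ a w k l r, new = .node a w k l r := by
  by_cases hi : ρ.inverse
  · have h : Oriented ρ.name ρ.mirrored new old := by simpa [Rotation.Rel, hi] using h
    exact ⟨(h.equivalent (h.ptrs_eq ▸ hg)).symm, h.ptrs_eq.symm, h.exists_node.symm⟩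
  · have h : Oriented ρ.name ρ.mirrored old new := by simpa [Rotation.Rel, hi] using h
    exact ⟨h.equivalent hg, h.ptrs_eq, h.exists_node⟩

/-! ### Weights along a path, and the special weight below a sentinel -/

theorem Patch.LeavesPositive.of_plug {C : List (Crumb K)} {t : Patch K}
    (h : (plug C t).LeavesPositive) : t.LeavesPositive := by
  induction C with
  | nil => exact h
  | cons c C ih =>
    obtain ⟨a, w, k, s, p⟩ := c
    cases s
    · exact ih h.1
    · exact ih h.2

theorem Patch.LeavesPositive.plug {C : List (Crumb K)} {O N : Patch K}
    (h : (plug C O).LeavesPositive) (hN : N.LeavesPositive) :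
    (Patch.plug C N).LeavesPositive := by
  induction C with
  | nil => exact hN
  | cons c C ih =>
    obtain ⟨a, w, k, s, p⟩ := c
    cases s
    · exact ⟨ih h.1, h.2⟩
    · exact ⟨h.1, ih h.2⟩

theorem Patch.PathWeight.plug {C : List (Crumb K)} {O N : Patch K} {n : ℕ}
    (h : (plug C O).PathWeight n) (hN : ∀ n, O.PathWeight n → N.PathWeight n) :
    (Patch.plug C N).PathWeight n := by
  induction C generalizing n with
  | nil => exact hN n h
  | cons c C ih =>
    obtain ⟨a, w, k, s, p⟩ := c
    cases s
    · obtain ⟨g, hg, hl, hr⟩ := h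
      exact ⟨g, hg, ih hl, hr⟩
    · obtain ⟨g, hg, hl, hr⟩ := h
      exact ⟨g, hg, hl, ih hr⟩

/-- `N` is `N₀`, or, below a sentinel at the lower end of the path `C`, `N₀` with another positive
weight of its topmost cell. -/
def Patch.Reweighted (C : List (Crumb K)) (N₀ N : Patch K) : Prop :=
  N = N₀ ∨ ∃ v, 1 ≤ v ∧ N = N₀.setWeight v ∧ ∀ D c, C = D ++ [c] → c.key = ⊤

theorem Patch.Reweighted.leaves_eq {C : List (Crumb K)} {N₀ N : Patch K}
    (h : Reweighted C N₀ N) : N.leaves = N₀.leaves := by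
  obtain rfl | ⟨v, -, rfl, -⟩ := h
  · rfl
  · simp

theorem Patch.In.exists_leaf {σ : Mem K} {t : Patch K} (h : t.In σ) {M : KeyNode K}
    (hM : M ∈ t.nodes) : ∃ a w, σ.cell a = some (.leaf w (some M)) := by
  induction t with
  | ptr => simp [Patch.nodes, Patch.leaves] at hM
  | leaf a w x =>
    obtain rfl : x = some M := by simpa using hM
    exact ⟨a, w, h⟩
  | node a w k l r ihl ihr =>
    rcases List.mem_append.1 ((nodes_node a w k l r) ▸ hM) with hM | hM
    · exact ihl h.2.1 hM
    · exact ihr h.2.2 hM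

theorem Patch.In.mark {σ : Mem K} (M : KeyNode K) {t : Patch K} (ht : t.In σ) :
    t.In { σ with marked := insert M σ.marked } := by
  induction t with
  | ptr => exact ht
  | leaf => exact ht
  | node a w k l r ihl ihr => exact ⟨ht.1, ihl ht.2.1, ihr ht.2.2⟩

theorem RemoveRule.spec {M : KeyNode K} {old new : Patch K} (h : RemoveRule M old new) :
    new.ptrs = old.ptrs ∧ (∃ a w k l r, old = .node a w k l r) ∧
      ∀ g : Addr → Patch K, (old.fill g).leaves = some M :: (new.fill g).leaves ∨
        (old.fill g).leaves = (new.fill g).leaves ++ [some M] := by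
  cases h with
  | left a b c w v k S h =>
    exact ⟨by simp [ptrs, ptrs_copy h], ⟨_, _, _, _, _, rfl⟩,
      fun g => .inl (by simp [fill, leaves, fill_copy h])⟩
  | right a b c w v k S h =>
    exact ⟨by simp [ptrs, ptrs_copy h], ⟨_, _, _, _, _, rfl⟩,
      fun g => .inr (by simp [fill, leaves, fill_copy h])⟩

section

variable [LinearOrder K]

/-! ### Replacing a subtree of a chromatic tree -/

/-- The subtree `O` of a chromatic tree can be replaced by `N`, which may have the additional
leaves in `X`. -/
structure Patch.CanReplace (X : Set (Option (KeyNode K))) (O N : Patch K) : Prop where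
  leaves : ∀ x ∈ N.leaves, x ∈ O.leaves ∨ x ∈ X
  closed : N.Closed
  search : O.IsSearchTree → N.IsSearchTree
  positive : O.LeavesPositive → N.LeavesPositive
  -- Positivity serves insertion, where the truncated `w - 1` must be a true difference.
  balanced : O.LeavesPositive → ∀ h, O.PathWeight h → N.PathWeight h

theorem Patch.Equivalent.canReplace {O N : Patch K} (h : Equivalent O N) (hO : O.Closed) :
    CanReplace ∅ O N where
  leaves _ hx := .inl (h.reshape.leaves_eq ▸ hx)
  closed := h.closed.1 hO
  search := h.reshape.search_iff.1
  positive := h.positive.1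
  balanced _ n := (h.pathWeight n).1

theorem Patch.IsSearchTree.of_plug {C : List (Crumb K)} {t : Patch K}
    (h : (plug C t).IsSearchTree) : t.IsSearchTree := by
  induction C with
  | nil => exact h
  | cons c C ih => exact ih h.of_fill

theorem Patch.IsSearchTree.plug {C : List (Crumb K)} {O N : Patch K}
    (h : (plug C O).IsSearchTree) (hN : N.IsSearchTree)
    (hx : ∀ x ∈ N.leaves, x ∈ O.leaves ∨ ∀ c ∈ C, c.Admits x) :
    (Patch.plug C N).IsSearchTree := by
  induction C with
  | nil => exact hN
  | cons c C ih =>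
    have ih := ih h.of_fill fun x hxN =>
      (hx x hxN).imp_right fun h c hc => h c (List.mem_cons_of_mem _ hc)
    obtain ⟨L₁, L₂, hL⟩ := leaves_plug C
    have hc : ∀ x ∈ N.leaves, x ∈ O.leaves ∨ c.Admits x := fun x hxN =>
      (hx x hxN).imp_right fun h => h c (by simp)
    have hsub : ∀ x ∈ (Patch.plug C N).leaves, x ∈ (Patch.plug C O).leaves ∨ c.Admits x := by
      intro x hxN
      rw [hL] at hxN ⊢
      simp only [List.mem_append] at hxN ⊢
      rcases hxN with (hxN | hxN) | hxN
      · exact .inl (.inl (.inl hxN))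
      · exact (hc x hxN).imp_left fun h => .inl (.inr h)
      · exact .inl (.inr hxN)
    obtain ⟨a, w, k, s, p⟩ := c
    cases s
    · exact ⟨fun x hx => (hsub x hx).elim (h.1 x) id, h.2.1, ih, h.2.2.2⟩
    · exact ⟨h.1, fun x hx => (hsub x hx).elim (h.2.1 x) id, h.2.2.1, ih⟩

/-- The right subtree of a cell with key infinity would have a leaf of key infinity, hence a
sentinel. So the special root weight can occur only at the root of the chromatic tree. -/
theorem Patch.IsChromaticTree.key_ne_top {C : List (Crumb K)} {c : Crumb K} {t : Patch K}
    (h : (plug (C ++ [c]) t).IsChromaticTree) : c.key ≠ ⊤ := by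
  have hs := h.search
  have hc := h.closed
  have hn := h.noSentinel
  rw [plug_append] at hs hc hn
  replace hs := hs.of_plug
  replace hc := hc.of_plug
  have key : ∀ x ∈ (plug [c] t).leaves, leafKey x < ⊤ := by
    intro x hx
    cases x with
    | none => exact absurd rfl (hn _ (leaves_subset_plug C _ hx))
    | some N => exact WithTop.coe_lt_top _
  obtain ⟨a, w, k, s, p⟩ := c
  rintro rfl
  cases s
  · obtain ⟨x, hx⟩ := List.exists_mem_of_ne_nil _ (Closed.leaves_ne_nil (t := p) hc.2)
    exact (hs.2.1 x hx).not_gt (key x (List.mem_append_right _ hx))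
  · obtain ⟨x, hx⟩ := List.exists_mem_of_ne_nil _ (Closed.leaves_ne_nil (t := t) hc.2)
    exact (hs.2.1 x hx).not_gt (key x (List.mem_append_right _ hx))

/-- Here `c` is the crumb of the sentinel above the chromatic tree, and `C` is the path inside it.
-/
theorem Patch.IsChromaticTree.plug {X : Set (Option (KeyNode K))} {C : List (Crumb K)}
    {O N N₀ : Patch K} {c : Crumb K} (h : (plug C O).IsChromaticTree) (hr : CanReplace X O N₀)
    (hX : ∀ x ∈ X, x ≠ none ∧ ∀ d ∈ C, d.Admits x) (hN : Reweighted (c :: C) N₀ N) :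
    (plug C N).IsChromaticTree := by
  have hl := hN.leaves_eq
  have hcl : N.Closed := by
    obtain rfl | ⟨v, -, rfl, -⟩ := hN
    · exact hr.closed
    · exact setWeight_closed.2 hr.closed
  have hse : N.IsSearchTree := by
    obtain rfl | ⟨v, -, rfl, -⟩ := hN
    · exact hr.search h.search.of_plug
    · exact setWeight_search.2 (hr.search h.search.of_plug)
  have hpo : N.LeavesPositive := by
    obtain rfl | ⟨v, hv, rfl, -⟩ := hN
    · exact hr.positive h.positive.of_plug
    · exact (hr.positive h.positive.of_plug).setWeight hv
  refine ⟨h.closed.plug hcl, ?_, ?_, h.positive.plug hpo, ?_⟩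
  · have hn := h.noSentinel
    obtain ⟨L₁, L₂, hL⟩ := leaves_plug C
    simp only [hL, List.mem_append] at hn ⊢
    rintro x ((hx | hx) | hx)
    · exact hn x (.inl (.inl hx))
    · rcases hr.leaves x (hl ▸ hx) with hx | hx
      · exact hn x (.inl (.inr hx))
      · exact (hX x hx).1
    · exact hn x (.inr hx)
  · exact h.search.plug hse fun x hx => (hr.leaves x (hl ▸ hx)).imp_right fun hx => (hX x hx).2
  · obtain ⟨n, hn⟩ := h.balanced
    have hb := hr.balanced h.positive.of_plug
    obtain rfl | ⟨v, -, rfl, hk⟩ := hN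
    · exact ⟨n, hn.plug hb⟩
    · rcases List.eq_nil_or_concat C with rfl | ⟨D, d, rfl⟩
      · exact (hb n hn).setWeight
      · rw [List.concat_eq_append] at h hk
        exact absurd (hk (c :: D) d (by simp)) h.key_ne_top

/-- The hypotheses on `C` and `O` place the hole inside the chromatic tree: neither at the entry
pointer nor at the right sentinel leaf. -/
theorem Patch.IsWholeTree.plug {X : Set (Option (KeyNode K))} {C : List (Crumb K)}
    {O N N₀ : Patch K} (h : (plug C O).IsWholeTree) (hC : C ≠ [])
    (hO : ∀ b v, O ≠ .leaf b v none) (hr : CanReplace X O N₀)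
    (hX : ∀ x ∈ X, x ≠ none ∧ ∀ d ∈ C, d.Admits x) (hN : Reweighted C N₀ N) :
    (plug C N).IsWholeTree := by
  obtain ⟨c, C, rfl⟩ := List.exists_cons_of_ne_nil hC
  have hX' : ∀ x ∈ X, x ≠ none ∧ ∀ d ∈ C, d.Admits x := fun x hx =>
    ⟨(hX x hx).1, fun d hd => (hX x hx).2 d (List.mem_cons_of_mem _ hd)⟩
  obtain ⟨a, w, h⟩ | ⟨a, w, t, b, v, h, ht⟩ := h
  · obtain ⟨a, w, k, s, p⟩ := c
    cases s <;> simp [Crumb.fill] at h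
  · obtain ⟨a', w', k, s, p⟩ := c
    cases s
    · simp only [plug_cons, Crumb.fill, node.injEq] at h
      obtain ⟨rfl, rfl, rfl, rfl, rfl⟩ := h
      exact .inr ⟨a', w', _, b, v, rfl, ht.plug hr hX' hN⟩
    · simp only [plug_cons, Crumb.fill, node.injEq] at h
      obtain ⟨-, -, -, -, h⟩ := h
      cases C with
      | nil => exact absurd h (hO b v)
      | cons d D =>
        obtain ⟨a, w, k, s, p⟩ := d
        cases s <;> simp [Crumb.fill] at h

theorem Patch.IsSearchTree.nodup_leaves {t : Patch K} (h : t.IsSearchTree) : t.leaves.Nodup := by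
  induction t with
  | ptr => simp [Patch.leaves]
  | leaf => simp [Patch.leaves]
  | node a w k l r ihl ihr =>
    exact List.nodup_append.2 ⟨ihl h.2.2.1, ihr h.2.2.2, fun x hl y hr e =>
      h.not_both hl (e ▸ hr)⟩

/-! ### Local consistency of a copy-on-write update -/

/-- What has to be checked, in a data structure `σ`, of a copy-on-write update. -/
structure SwingCorrect (R : Set (KeyNode K)) (q : Slot) (old new : Patch K) (σ : Mem K) :
    Prop where
  ptrs : new.ptrs ⊆ old.ptrs
  whole : ∀ C : List (Crumb K), (plug C (old.expand σ)).IsWholeTree →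
    (plug C (old.expand σ)).addr = σ.root → (plug C (old.expand σ)).In σ → q.EndsPath C →
    (plug C (new.expand σ)).IsWholeTree ∧
      ∀ M ∈ R, M ∈ (plug C (old.expand σ)).nodes → M ∉ (plug C (new.expand σ)).nodes
  agree : AgreeOff R (old.expand σ).nodes (new.expand σ).nodes

variable {R : Set (KeyNode K)} {q : Slot} {old new : Patch K} {σ : Mem K}

theorem SwingCorrect.isStructure (h : SwingCorrect R q old new σ) (hσ : IsStructure σ)
    (hr : Replaceable σ q old new) : IsStructure (σ.swung q new) := by
  obtain ⟨C, h1, h2, h3, h4, h5, h6⟩ := hr.exists_plug hσ h.ptrs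
  exact ⟨⟨_, h4, h5, (h.whole C h1 h2 h3 h6).1⟩, fun a ha => hr.memory hσ h.ptrs ha⟩

/-- This makes the clause on `V(N, ·)` vacuous for `N` in the change set. -/
theorem SwingCorrect.not_mem_nodes (h : SwingCorrect R q old new σ) (hσ : IsStructure σ)
    (hr : Replaceable σ q old new) {M : KeyNode K} (hM : M ∈ R) (h0 : M ∈ nodes σ) :
    M ∉ nodes (σ.swung q new) := by
  have hσ' := h.isStructure hσ hr
  obtain ⟨C, h1, h2, h3, h4, h5, h6⟩ := hr.exists_plug hσ h.ptrs
  obtain ⟨h7, h8⟩ := h.whole C h1 h2 h3 h6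
  rw [hσ.mem_nodes, treeAt_eq h1.closed h3 h2] at h0
  rw [hσ'.mem_nodes, treeAt_eq h7.closed h5 h4]
  exact h8 M hM h0

theorem locallyConsistent_swing {c : Mem K → Prop}
    (h : ∀ σ, IsStructure σ → Replaceable σ q old new → c σ → SwingCorrect R q old new σ) :
    IsMutator (swing c q old new) ∧ LocallyConsistent (swing c q old new) R := by
  constructor
  · intro σ hσ
    unfold swing
    split
    · rename_i hc
      exact (h σ hσ hc.1 hc.2).isStructure hσ hc.1
    · exact hσ
  · intro σ hσ
    unfold swing
    split
    · rename_i hc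
      have hs := h σ hσ hc.1 hc.2
      have hσ' := hs.isStructure hσ hc.1
      have hf := hc.1.framesAgree hσ hs.ptrs hs.agree
      have hm : ∀ M ∉ R, M ∈ σ.marked ↔ M ∈ (σ.swung q new).marked := fun M _ => by
        rw [Replaceable.swung_marked]
      refine ⟨fun N hN hNR => ?_, fun s hs => hf.iterView_symmDiff hσ hσ' hm hs⟩
      by_cases hN' : N ∈ R
      · exact absurd (hNR hN') (hs.not_mem_nodes hσ hc.1 hN' hN)
      · exact hf.nodeView_symmDiff hσ hσ' hm hN'
    · exact ⟨fun N _ _ => by simp, fun s _ => by simp⟩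

theorem preservesViews_swing {c : Mem K → Prop}
    (h : ∀ σ, IsStructure σ → Replaceable σ q old new → c σ →
      SwingCorrect R q old new σ ∧ R ⊆ σ.marked) :
    PreservesViews (swing c q old new) := by
  intro σ hσ s hs
  unfold swing
  split
  · rename_i hc
    obtain ⟨hw, hR⟩ := h σ hσ hc.1 hc.2
    exact (hc.1.framesAgree hσ hw.ptrs hw.agree).iterView_eq hσ (hw.isStructure hσ hc.1)
      (Replaceable.swung_marked σ q new) hR hs
  · rfl

end

/-- The exceptional weight is moved from the hypothesis to the result: `new` is an ordinary result
`new₀` with weight reset to one. Weight one rules out a bare pointer. -/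
theorem UpToRootWeight.cases {rel : Patch K → Patch K → Prop} {q : Slot} {old new : Patch K}
    {σ : Mem K} (h : UpToRootWeight rel q old new σ) :
    ∃ new₀, rel old new₀ ∧
      (new = new₀ ∨ (∀ e, new₀ ≠ .ptr e) ∧ new = new₀.setWeight 1 ∧ q.IsSentinel σ) := by
  obtain h | ⟨hq, hw, w, h⟩ := h
  · exact ⟨new, h, .inl rfl⟩
  · refine ⟨_, h, .inr ⟨?_, ?_, hq⟩⟩
    · cases new with
      | ptr => exact absurd hw (by simp [weight])
      | leaf => simp [setWeight]
      | node => simp [setWeight]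
    · cases new with
      | ptr => rfl
      | leaf => obtain rfl := hw; rfl
      | node => obtain rfl := hw; rfl

section

variable {q : Slot} {new₀ old new : Patch K} {σ : Mem K}

theorem ptrs_of_cases
    (h : new = new₀ ∨ (∀ e, new₀ ≠ .ptr e) ∧ new = new₀.setWeight 1 ∧ q.IsSentinel σ) :
    new.ptrs = new₀.ptrs := by
  obtain rfl | ⟨-, rfl, -⟩ := h
  · rfl
  · simp

theorem nodes_expand_of_cases
    (h : new = new₀ ∨ (∀ e, new₀ ≠ .ptr e) ∧ new = new₀.setWeight 1 ∧ q.IsSentinel σ) :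
    (new.expand σ).nodes = (new₀.expand σ).nodes := by
  obtain rfl | ⟨h, rfl, -⟩ := h
  · rfl
  · rw [expand, fill_setWeight h, nodes_setWeight]
    rfl

theorem reweighted_of_cases
    (h : new = new₀ ∨ (∀ e, new₀ ≠ .ptr e) ∧ new = new₀.setWeight 1 ∧ q.IsSentinel σ)
    {C : List (Crumb K)} {O : Patch K} (ht : (plug C O).In σ) (hq : q.EndsPath C) :
    Reweighted C (new₀.expand σ) (new.expand σ) := by
  obtain rfl | ⟨h, rfl, hs⟩ := h
  · exact .inl rfl
  · refine .inr ⟨1, le_rfl, fill_setWeight h _ _, ?_⟩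
    rintro D c rfl
    obtain ⟨-, h⟩ | ⟨D', c', h, rfl⟩ := hq
    · simp at h
    · obtain ⟨-, h⟩ := List.append_inj' h rfl
      obtain rfl : c = c' := by simpa using h
      obtain ⟨w, l, r, hs⟩ := hs
      rw [plug_append] at ht
      have := ht.of_plug
      obtain ⟨a, v, k, s, p⟩ := c
      cases s <;>
      · have e := hs.symm.trans this.1
        simp only [Option.some.injEq, Cell.internal.injEq] at e
        exact e.2.1.symm

end

section

variable [LinearOrder K] {q : Slot} {old new : Patch K} {σ : Mem K}

/-! ### Rebalancing -/

theorem rotation_correct {ρ : Rotation} (hσ : IsStructure σ) (hr : Replaceable σ q old new)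
    (h : UpToRootWeight ρ.Rel q old new σ) (hs : ¬ old.IsSentinel) :
    SwingCorrect ∅ q old new σ := by
  obtain ⟨new₀, hrel, hnew⟩ := h.cases
  obtain ⟨heq, hp, ⟨a, w, k, l, r, rfl⟩, -⟩ := hrel.spec (g := treeAt σ)
    fun b hb => (hσ.treeAt_spec (hr.present.ptrs b hb)).2.1
  obtain ⟨e1, e2, e3⟩ := hr.expand_old hσ
  refine ⟨by rw [ptrs_of_cases hnew, hp]; exact fun _ h => h, ?_, ?_⟩
  · intro C h1 h2 h3 h4
    refine ⟨?_, by simp⟩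
    refine h1.plug ?_ (fun b v => by simp [expand, fill]) (heq.canReplace e2) (by simp)
      (reweighted_of_cases hnew h3 h4)
    -- At the entry pointer the topmost cell of `old` would be the sentinel.
    rintro rfl
    obtain ⟨b, v, h⟩ | ⟨b, v, t, b', v', h, ht⟩ := h1
    · simp [expand, fill] at h
    · simp only [plug_nil, expand, fill, node.injEq] at h
      exact hs h.2.2.1
  · rw [nodes_expand_of_cases hnew, Patch.nodes, Patch.nodes, expand, expand, heq.reshape.leaves_eq]
    exact .refl _ _

theorem rotation_locallyConsistent (ρ : Rotation) : OpLocallyConsistent (ρ.steps K) ∅ := by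
  rintro _ ⟨q, old, new, rfl⟩
  exact locallyConsistent_swing fun σ hσ hr hc => rotation_correct hσ hr hc.1 hc.2

theorem rotation_preservesViews (ρ : Rotation) : ∀ m ∈ ρ.steps K, PreservesViews m := by
  rintro _ ⟨q, old, new, rfl⟩
  exact preservesViews_swing fun σ hσ hr hc =>
    ⟨rotation_correct hσ hr hc.1 hc.2, Set.empty_subset _⟩

/-! ### Insertion -/

/-- The weight `w` of the old leaf is split as `(w - 1) + 1` along both new paths. -/
theorem InsertRule.canReplace {u : KeyNode K} {old new : Patch K} (h : InsertRule u old new)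
    (g : Addr → Patch K) : CanReplace {some u} (old.fill g) (new.fill g) := by
  cases h with
  | left a n b c w x h =>
    exact ⟨fun y hy => by simpa [fill, leaves, or_comm] using hy, ⟨trivial, trivial⟩,
      fun _ => ⟨by simpa [fill, leaves, leafKey] using h, by simp [fill, leaves], trivial, trivial⟩,
      fun _ => ⟨le_rfl, le_rfl⟩, fun hw n hn => ⟨1, hn.trans (Nat.sub_add_cancel hw).symm, rfl, rfl⟩⟩
  | right a n b c w x h =>
    exact ⟨fun y hy => by simpa [fill, leaves] using hy, ⟨trivial, trivial⟩,
      fun _ => ⟨by simpa [fill, leaves] using h, by simp [fill, leaves, leafKey], trivial, trivial⟩,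
      fun _ => ⟨le_rfl, le_rfl⟩, fun hw n hn => ⟨1, hn.trans (Nat.sub_add_cancel hw).symm, rfl, rfl⟩⟩

theorem InsertRule.agree {u : KeyNode K} {old new : Patch K} (h : InsertRule u old new)
    (g : Addr → Patch K) : AgreeOff {u} (old.fill g).nodes (new.fill g).nodes := by
  cases h <;> simp [fill, AgreeOff]

theorem InsertRule.spec {u : KeyNode K} {old new : Patch K} (h : InsertRule u old new) :
    new.ptrs = [] ∧ ∃ a w x, old = .leaf a w x ∧
      (x = none → ∃ n v b c, new = .node n v ⊤ (.leaf b 1 (some u)) (.leaf c 1 none)) := by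
  cases h with
  | left a n b c w x h =>
    exact ⟨rfl, a, w, x, rfl, by rintro rfl; exact ⟨_, _, _, _, rfl⟩⟩
  | right a n b c w x h =>
    exact ⟨rfl, a, w, x, rfl, by rintro rfl; exact absurd h not_top_lt⟩

theorem insertion_correct {u : KeyNode K} (hσ : IsStructure σ) (hr : Replaceable σ q old new)
    (h : UpToRootWeight (InsertRule u) q old new σ) (hu : OnSearchPath σ u.key old.addr)
    (hf : ∀ a w, σ.cell a ≠ some (.leaf w (some u))) : SwingCorrect {u} q old new σ := by
  obtain ⟨new₀, hrel, hnew⟩ := h.cases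
  obtain ⟨hp, a, w, x, hold, hx⟩ := hrel.spec
  obtain ⟨e1, e2, e3⟩ := hr.expand_old hσ
  refine ⟨by rw [ptrs_of_cases hnew, hp]; exact List.nil_subset _, ?_, ?_⟩
  · intro C h1 h2 h3 h4
    refine ⟨?_, ?_⟩
    · have hC : ∀ c ∈ C, c.Admits (some u) := by
        obtain ⟨D, A, hA, hA', hD⟩ := hu.exists_plug h2 h1.closed h3
        have hc := h1.closed
        have hi := h3
        rw [hA] at hc hi
        obtain rfl := hi.of_plug.unique e3 hc.of_plug e2 (hA'.trans e1.symm)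
        rwa [plug_injective h1.search h1.closed hA]
      -- At the entry pointer the set was empty: the old leaf is the sentinel leaf, and `new` is a
      -- sentinel above the single leaf of `u`.
      by_cases hnil : C = []
      · subst hnil hold
        obtain ⟨b, v, h⟩ | ⟨b, v, t, b', v', h, ht⟩ := h1
        · simp only [plug_nil, expand, fill, leaf.injEq] at h
          obtain ⟨n, v, b, c, rfl⟩ := hx h.2.2
          have key : ∀ v, (node n v ⊤ (.leaf b 1 (some u)) (.leaf c 1 none)).IsWholeTree :=
            fun v => .inr ⟨n, v, _, c, 1, rfl, trivial, by simp [leaves], trivial, le_rfl, 1, rfl⟩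
          obtain rfl | ⟨-, rfl, -⟩ := hnew
          · exact key v
          · exact key 1
        · simp [expand, fill] at h
      · refine h1.plug hnil ?_ (hrel.canReplace _) ?_ (reweighted_of_cases hnew h3 h4)
        -- The right sentinel leaf is never the target, as a search for a finite key does not turn
        -- right at infinity.
        · intro b v hb
          rw [hb] at h1 h3
          obtain ⟨c, C, rfl⟩ := List.exists_cons_of_ne_nil hnil
          have hc := hC c (by simp)
          obtain ⟨a, w, h⟩ | ⟨a, w, t, b, v, h, ht⟩ := h1
          · obtain ⟨a, w, k, s, p⟩ := c
            cases s <;> simp [Crumb.fill] at h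
          · obtain ⟨a', w', k, s, p⟩ := c
            cases s
            · simp only [plug_cons, Crumb.fill, node.injEq] at h
              obtain ⟨-, -, -, rfl, -⟩ := h
              exact ht.noSentinel none (leaves_subset_plug C _ (by simp [leaves])) rfl
            · simp only [plug_cons, Crumb.fill, node.injEq] at h
              obtain ⟨-, -, rfl, -⟩ := h
              exact absurd hc (by simp [Crumb.Admits, leafKey])
        · rintro x rfl
          exact ⟨by simp, hC⟩
    · rintro M rfl hM
      obtain ⟨a, w, h⟩ := h3.exists_leaf hM
      exact absurd h (hf a w)
  · rw [nodes_expand_of_cases hnew]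
    exact hrel.agree _

theorem insertion_locallyConsistent (u : KeyNode K) : OpLocallyConsistent (insertion u) {u} := by
  rintro _ ⟨q, old, new, rfl⟩
  exact locallyConsistent_swing fun σ hσ hr hc =>
    insertion_correct hσ hr hc.1 hc.2.1 hc.2.2.2

/-! ### Deletion -/

theorem RemoveRule.canReplace {M : KeyNode K} {old new : Patch K} (h : RemoveRule M old new)
    {g : Addr → Patch K} (hc : (old.fill g).Closed) :
    CanReplace ∅ (old.fill g) (new.fill g) := by
  have hl : ∀ x ∈ (new.fill g).leaves, x ∈ (old.fill g).leaves ∨ x ∈ (∅ : Set _) := by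
    intro x hx
    rcases h.spec.2.2 g with e | e <;> simp [e, hx]
  refine ⟨hl, ?_, ?_, ?_, ?_⟩ <;> clear hl <;> cases h with
  | left a b c w v k S h =>
    rw [fill_copy h]
    rw [← fill_weight h g]
    first
    | exact copy_closed.2 hc.2
    | exact fun hs => copy_search.2 hs.2.2.2
    | exact fun hp => hp.2.copy (Nat.le_add_left _ _)
    | rintro hp n ⟨m, rfl, -, hr⟩
      exact hr.copy_add
  | right a b c w v k S h =>
    rw [fill_copy h]
    rw [← fill_weight h g]
    first
    | exact copy_closed.2 hc.1
    | exact fun hs => copy_search.2 hs.2.2.1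
    | exact fun hp => hp.1.copy (Nat.le_add_left _ _)
    | rintro hp n ⟨m, rfl, hr, -⟩
      exact hr.copy_add

/-- Removing directly below the entry pointer empties the set: the sibling of the leaf of `M` is
then the sentinel leaf. -/
theorem RemoveRule.whole {M : KeyNode K} {old new : Patch K} (h : RemoveRule M old new)
    {g : Addr → Patch K} (hw : (old.fill g).IsWholeTree) : ∃ a w, new.fill g = .leaf a w none := by
  obtain ⟨b, v, hw⟩ | ⟨b, v, t, b', v', hw, ht⟩ := hw
  · obtain ⟨-, ⟨a, w, k, l, r, rfl⟩, -⟩ := h.spec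
    simp [fill] at hw
  · cases h with
    | left a b c w v k S h =>
      simp only [fill, node.injEq] at hw
      rw [fill_copy h, hw.2.2.2.2]
      exact ⟨_, _, rfl⟩
    | right a b c w v k S h => simp [fill] at hw

theorem removal_correct {M : KeyNode K} (hσ : IsStructure σ) (hr : Replaceable σ q old new)
    (h : UpToRootWeight (RemoveRule M) q old new σ) : SwingCorrect {M} q old new σ := by
  obtain ⟨new₀, hrel, hnew⟩ := h.cases
  obtain ⟨hp, ⟨a, w, k, l, r, hold⟩, hl⟩ := hrel.spec
  obtain ⟨e1, e2, e3⟩ := hr.expand_old hσ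
  refine ⟨by rw [ptrs_of_cases hnew, hp]; exact fun _ h => h, ?_, ?_⟩
  · intro C h1 h2 h3 h4
    refine ⟨?_, ?_⟩
    · by_cases hnil : C = []
      · subst hnil
        obtain ⟨b, v, hb⟩ := hrel.whole h1
        obtain rfl | ⟨hptr, rfl, -⟩ := hnew
        · exact .inl ⟨b, v, hb⟩
        · exact .inl ⟨b, 1, by rw [plug_nil, expand, fill_setWeight hptr, hb]; rfl⟩
      · exact h1.plug hnil (fun b v => by simp [hold, expand, fill]) (hrel.canReplace e2)
          (by simp) (reweighted_of_cases hnew h3 h4)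
    · rintro _ rfl - hM
      -- The leaves of a search tree are distinct, so `M` has no leaf besides the removed one.
      have hd := h1.search.nodup_leaves
      obtain ⟨L₁, L₂, hL⟩ := leaves_plug C
      have hN := (reweighted_of_cases hnew h3 h4).leaves_eq
      rw [mem_nodes, hL, hN] at hM
      rw [hL] at hd
      unfold expand at hd hM
      rcases hl (treeAt σ) with e | e <;> rw [e] at hd <;>
        simp [List.nodup_append, List.nodup_cons] at hd hM <;> grind
  · rw [nodes_expand_of_cases hnew, expand, expand, Patch.nodes, Patch.nodes]
    rcases hl (treeAt σ) with e | e <;> rw [e] <;>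
      simp [AgreeOff, List.reduceOption_append, List.reduceOption_cons_of_some]

theorem removal_locallyConsistent (M : KeyNode K) : OpLocallyConsistent (removalSteps M) {M} := by
  rintro _ ⟨q, old, new, rfl⟩
  exact locallyConsistent_swing fun σ hσ hr hc => removal_correct hσ hr hc.1

theorem removal_preservesViews (M : KeyNode K) : ∀ m ∈ removalSteps M, PreservesViews m := by
  rintro _ ⟨q, old, new, rfl⟩
  exact preservesViews_swing (R := {M}) fun σ hσ hr hc =>
    ⟨removal_correct hσ hr hc.1, by simpa using hc.2⟩

theorem mark_locallyConsistent (M : KeyNode K) :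
    IsMutator (markStep M) ∧ LocallyConsistent (markStep M) {M} := by
  have hs : ∀ σ : Mem K, IsStructure σ →
      IsStructure { σ with marked := insert M σ.marked } := by
    intro σ hσ
    obtain ⟨t, h1, h2, h3⟩ := hσ.tree
    refine ⟨⟨t, h1, h2.mark M, h3⟩, fun a ha => ?_⟩
    obtain ⟨t, h1, h2, h3⟩ := hσ.memory a ha
    exact ⟨t, h1, h2, h3.mark M⟩
  constructor
  · intro σ hσ
    unfold markStep
    split
    · exact hs σ hσ
    · exact hσ
  · intro σ hσ
    unfold markStep
    split
    · have hσ' := hs σ hσ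
      have key : ∀ a, σ.cell a ≠ none →
          treeAt { σ with marked := insert M σ.marked } a = treeAt σ a := by
        intro a ha
        obtain ⟨h1, h2, h3⟩ := hσ.treeAt_spec ha
        exact treeAt_eq h2 (h3.mark M) h1
      have hroot := key _ hσ.root_ne_none
      -- No exception for `N = M` is needed: the visiting order is unchanged, and only membership of
      -- `M` itself can change.
      refine ⟨fun N _ _ => ?_, fun s hs => ?_⟩
      · intro P hP
        by_contra hPM
        have hPM : P ≠ M := hPM
        rw [Set.mem_symmDiff, hσ.mem_nodeView, hσ'.mem_nodeView] at hP
        simp only [hroot, Set.mem_insert_iff, hPM, false_or] at hP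
        tauto
      · have hf : FramesAgree {M} σ { σ with marked := insert M σ.marked } := by
          refine ⟨fun a h => h, ?_, fun a ha => ?_, fun a ha => ?_⟩
          · simp only [frameNodes, hroot]
            exact .refl _ _
          · simp only [frameNodes, key a ha]
            exact .refl _ _
          · simp only [frameNodes, key a ha]
            exact .refl _ _
        exact hf.iterView_symmDiff hσ hσ' (fun P (hP : P ≠ M) => by simp [hP]) hs
    · exact ⟨fun N _ _ => by simp, fun s _ => by simp⟩

theorem deletion_locallyConsistent (M : KeyNode K) : OpLocallyConsistent (deletion M) {M} := by
  rintro m (rfl | hm)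
  · exact mark_locallyConsistent M
  · exact removal_locallyConsistent M m hm

end

end Chromatic

open Chromatic in
theorem mainTheorem4 {K : Type*} [LinearOrder K] :
    (∀ u : KeyNode K, OpLocallyConsistent (insertion u) {u}) ∧
    (∀ M : KeyNode K, OpLocallyConsistent (deletion M) {M} ∧
      ∀ m ∈ removalSteps M, PreservesViews m) ∧
    (∀ ρ : Rotation, OpLocallyConsistent (ρ.steps K) ∅ ∧
      ∀ m ∈ ρ.steps K, PreservesViews m) :=
  ⟨insertion_locallyConsistent,
    fun M => ⟨deletion_locallyConsistent M, removal_preservesViews M⟩,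
    fun ρ => ⟨rotation_locallyConsistent ρ, rotation_preservesViews ρ⟩⟩
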